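/- Let $M$ be a field that is complete with respect to a non-trivial discrete valuation and has finite residue field of characteristic $p$; let $\mathcal{O}_M$ denote its valuation ring. Let $L/M$ be a totally ramified finite Galois extension with Galois group $I$, let $\mathcal{O}_L$ be the valuation ring of $L$, $\mathfrak{P}_L$ its maximal ideal, and let $$G_i=\{\sigma\in I : (\sigma-1)(\mathcal{O}_L)\subseteq \mathfrak{P}_L^{\,i+1}\}\qquad (i\ge 0)$$ be the ramification groups in the lower numbering. Suppose that $L/M$ is weakly ramified, i.e. that $G_2$ is trivial. Let $W=G_1$, a normal subgroup of $p$-power order $|W|=p^r$, and let $C$ be a (necessarily cyclic) complement of $W$ in $I$, so that $I=W\rtimes C$. Put $c=|C|$ and let $E=L^W$ and $F=L^C$ be the fixed fields of $W$ and $C$. Let $a,b\in\mathbb{Z}$ satisfy $ap^r+bc=1$. Let $\pi_E$ and $\pi_M$ be uniformizers of $E$ and $M$, respectively, such that $\pi_E^{c}=\pi_M$, and let $\pi_F$ be any uniformizer of $F$. Let $n\in\mathbb{Z}$ with $n\equiv 1 \pmod{|W|}$, let $u_0,\dots,u_{c-1}\in\mathcal{O}_M^{\times}$, and let $$\alpha=u_0+u_1\pi_E+\cdots+u_{c-1}\pi_E^{\,c-1}.$$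 Then $\pi_F^{\,nb}\,\pi_E^{\,na}\,\alpha$ is a free generator of the fractional ideal $\mathfrak{P}_L^{\,n}$ over the group ring $\mathcal{O}_M[I]$; that is, the map $\mathcal{O}_M[I]\to L$, $\sum_{\sigma} r_\sigma\sigma\mapsto \sum_\sigma r_\sigma\,\sigma(\pi_F^{\,nb}\pi_E^{\,na}\alpha)$, is injective with image $\mathfrak{P}_L^{\,n}$. -/

import Mathlib

open scoped Valued WithZero

/-- `K`, with its valuation `v : K → ℤᵐ⁰` (written multiplicatively, so that `v x = exp (-m)` means
that the additive valuation of `x` is `m`), is a complete local field: `v` is the normalised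
discrete valuation, i.e. it takes every value in `ℤᵐ⁰`, and `K` is complete with respect to it. -/
class IsCompleteLocalField (K : Type*) [Field K] [Valued K ℤᵐ⁰] : Prop where
  surjective : Function.Surjective (Valued.v : Valuation K ℤᵐ⁰)
  complete : CompleteSpace K

/-- `π` is a uniformizer for the valuation `v` of the field `K`: it is a generator of the maximal
ideal `{y | v y < 1}` of the valuation ring of `v`, and it is nonzero. -/
def IsUniformizerFor {K : Type*} [Field K] (v : Valuation K ℤᵐ⁰) (π : K) : Prop :=
  π ≠ 0 ∧ ∀ y : K, v y < 1 ↔ v y ≤ v π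

/-- The power `𝔓 ^ n` (`n ∈ ℤ`) of the maximal ideal `𝔓` of the valuation ring of `K`, as a
fractional ideal in `K`: the elements whose normalised additive valuation is at least `n`. -/
def idealPow (K : Type*) [Field K] [Valued K ℤᵐ⁰] (n : ℤ) : Submodule 𝒪[K] K where
  carrier := {x | Valued.v x ≤ WithZero.exp (-n)}
  zero_mem' := by simp
  add_mem' := fun {x y} hx hy => by
    have h : Valued.v (x + y) ≤ WithZero.exp (-n) :=
      (Valuation.map_add _ x y).trans (max_le hx hy)
    exact h
  smul_mem' := fun r x hx => by
    have h : Valued.v ((r : K) * x) ≤ 1 * WithZero.exp (-n) := by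
      rw [map_mul]
      exact mul_le_mul' r.2 hx
    simpa [Subring.smul_def] using h

theorem mem_idealPow {K : Type*} [Field K] [Valued K ℤᵐ⁰] {n : ℤ} {x : K} :
    x ∈ idealPow K n ↔ Valued.v x ≤ WithZero.exp (-n) :=
  Iff.rfl

section Extension

variable (M L : Type*) [Field M] [Field L] [Algebra M L]

/-- `L / M` is totally ramified: for the normalised valuations, the valuation of `L` restricts to
`[L : M]` times the valuation of `M` (so the former extends the latter up to normalisation, and
the ramification index is the degree). -/
def IsTotallyRamified [Valued M ℤᵐ⁰] [Valued L ℤᵐ⁰] : Prop :=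
  ∀ x : M, (Valued.v (algebraMap M L x) : ℤᵐ⁰) = Valued.v x ^ Module.finrank M L

/-- The ramification group `G_i = {σ | (σ - 1) 𝒪_L ⊆ 𝔓_L ^ (i + 1)}` in the lower numbering. -/
def ramificationGroup [Valued L ℤᵐ⁰] [FiniteDimensional M L] (i : ℕ) : Subgroup Gal(L/M) :=
  let S : Submonoid Gal(L/M) :=
    { carrier := {σ | ∀ x ∈ 𝒪[L], σ x - x ∈ idealPow L (i + 1)}
      one_mem' := fun x _ => by simp
      mul_mem' := fun {σ τ} hσ hτ x hx => by
        have h1 := hτ x hx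
        have h2 : τ x - x ∈ 𝒪[L] := by
          refine le_trans (mem_idealPow.1 h1) ?_
          rw [← WithZero.exp_zero, WithZero.exp_le_exp]
          omega
        have h3 := add_mem (add_mem (hσ _ h2) h1) (hσ x hx)
        have h4 : (σ * τ) x - x = σ (τ x - x) - (τ x - x) + (τ x - x) + (σ x - x) := by
          simp [AlgEquiv.mul_apply]
        rw [h4]
        exact h3 }
  { S with
    inv_mem' := fun {σ} hσ => by
      have h : σ⁻¹ ∈ Submonoid.powers σ := by
        rw [mem_powers_iff_mem_zpowers]
        exact inv_mem (Subgroup.mem_zpowers σ)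
      obtain ⟨k, hk⟩ := h
      have h' : σ ^ k ∈ S := pow_mem (show σ ∈ S from hσ) k
      have hk' : σ ^ k = σ⁻¹ := hk
      rw [hk'] at h'
      exact h' }

theorem mem_ramificationGroup [Valued L ℤᵐ⁰] [FiniteDimensional M L] (i : ℕ) (σ : Gal(L/M)) :
    σ ∈ ramificationGroup M L i ↔ ∀ x ∈ 𝒪[L], σ x - x ∈ idealPow L (i + 1) :=
  Iff.rfl

/-- `L / M` is weakly ramified: the second ramification group is trivial. -/
def IsWeaklyRamified [Valued L ℤᵐ⁰] [FiniteDimensional M L] : Prop := ramificationGroup M L 2 = ⊥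

/-- The natural action of the group ring `𝒪_M[Gal(L/M)]` on `L`. -/
noncomputable def groupRingAction [Valued M ℤᵐ⁰] :
    MonoidAlgebra 𝒪[M] Gal(L/M) →ₐ[𝒪[M]] Module.End 𝒪[M] L :=
  (Representation.ofDistribMulAction 𝒪[M] Gal(L/M) L).asAlgebraHom

theorem groupRingAction_apply [Valued M ℤᵐ⁰] (x : MonoidAlgebra 𝒪[M] Gal(L/M)) (δ : L) :
    groupRingAction M L x δ = x.coeff.sum fun σ r => algebraMap M L r * σ δ := by
  simp only [groupRingAction, Representation.asAlgebraHom_def, MonoidAlgebra.lift_apply,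
    Finsupp.sum, LinearMap.sum_apply, LinearMap.smul_apply,
    Representation.ofDistribMulAction_apply_apply, AlgEquiv.smul_def, Subring.smul_def]
  simp only [Algebra.smul_def]

variable {L} in
/-- `δ` is a free generator of the subset `N` of `L` as a module over `𝒪_M[Gal(L/M)]`: the map
`x ↦ x • δ` is a bijection from `𝒪_M[Gal(L/M)]` onto `N`. -/
def IsFreeGenerator [Valued M ℤᵐ⁰] (N : Set L) (δ : L) : Prop :=
  Set.BijOn (fun x => groupRingAction M L x δ) Set.univ N

end Extension

/-! Put q = |W|, c = |C|, N = qc = [L : M], and let v be the additive valuation of L. For δ with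
v(δ) = n it suffices that v(∑ r_σ σ(δ)) < v(r_τ) + n + N whenever the r_σ lie in M and r_τ ≠ 0
(`isFreeGenerator_of_val_mul_lt`). The sum is then nonzero, so the conjugates of δ form an M-basis
of L. If the sum lies in 𝔓^n, then v(r_τ) > -N; as v(r_τ) is a multiple of N, r_τ is integral.

Writing σ = wg with w ∈ W and g ∈ C turns the sum into ∑ e_w w(x), where x = π_F^(nb) is fixed by C
and e_w = ∑_g r_(wg) g(π_E^(na) α) lies in E. The two layers are estimated separately.

Tame layer (`val_mul_lt_val_sum_tame`): C acts on π_E through a faithful character with values in M,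
so the coefficients of e_w along the powers of π_E are, up to units, the Fourier transform of r.
Since c is a unit, Fourier inversion loses nothing, and the terms have distinct valuations modulo N.

Wild layer (`val_mul_lt_val_sum_ramificationGroup_one`): here v(x) ≡ 1 mod q. A violation of the
bound gives a nonzero W-stable subgroup of k^W, with k the residue field of M. As W is a p-group,
this subgroup contains a nonzero constant vector, which makes the trace of x to E too small. The
exact valuation of that trace (`val_sum_ramificationGroup_one`) comes from Euler's formula and the
triviality of G_2. -/

section Values

/-! ### Arithmetic in the value group. -/

theorem WithZero.eq_exp_log {γ : ℤᵐ⁰} (hγ : γ ≠ 0) : ∃ k : ℤ, γ = WithZero.exp k :=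
  ⟨_, (WithZero.exp_log hγ).symm⟩

theorem WithZero.lt_exp_iff_le_exp_sub_one {γ : ℤᵐ⁰} {k : ℤ} :
    γ < WithZero.exp k ↔ γ ≤ WithZero.exp (k - 1) := by
  rcases eq_or_ne γ 0 with rfl | h
  · simp only [zero_le, iff_true]
    exact zero_lt_iff.2 WithZero.exp_ne_zero
  · obtain ⟨m, rfl⟩ := WithZero.eq_exp_log h
    rw [WithZero.exp_lt_exp, WithZero.exp_le_exp]
    omega

theorem WithZero.lt_one_iff_le_exp_neg_one {γ : ℤᵐ⁰} : γ < 1 ↔ γ ≤ WithZero.exp (-1) := by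
  rw [← WithZero.exp_zero, WithZero.lt_exp_iff_le_exp_sub_one, zero_sub]

theorem WithZero.exp_pow_eq {k : ℤ} {n : ℕ} :
    (WithZero.exp k : ℤᵐ⁰) ^ n = WithZero.exp (n * k) := by
  rw [← WithZero.exp_nsmul, nsmul_eq_mul]

theorem WithZero.exp_zpow_eq {k n : ℤ} :
    (WithZero.exp k : ℤᵐ⁰) ^ n = WithZero.exp (n * k) := by
  rw [← WithZero.exp_zsmul, smul_eq_mul]

theorem WithZero.exp_mul_exp {a b : ℤ} :
    (WithZero.exp a : ℤᵐ⁰) * WithZero.exp b = WithZero.exp (a + b) := rfl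

theorem WithZero.mul_exp_le_exp_iff {γ : ℤᵐ⁰} {a b : ℤ} :
    γ * WithZero.exp a ≤ WithZero.exp b ↔ γ ≤ WithZero.exp (b - a) := by
  rcases eq_or_ne γ 0 with rfl | h
  · simp
  · obtain ⟨m, rfl⟩ := WithZero.eq_exp_log h
    rw [WithZero.exp_mul_exp, WithZero.exp_le_exp, WithZero.exp_le_exp]
    omega

theorem Fin.eq_of_mul_sub_eq {s : ℕ} {i j : Fin s} {k l : ℤ}
    (h : (s : ℤ) * k - (i : ℕ) = s * l - (j : ℕ)) : i = j := by
  have h1 : (i : ℤ) - j = s * (k - l) := by linarith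
  have h2 := i.2
  have h3 := j.2
  have h4 : (s : ℤ) * (k - l) < s := by omega
  have h5 : -(s : ℤ) < s * (k - l) := by omega
  have h6 : k - l < 1 := by nlinarith
  have h7 : -1 < k - l := by nlinarith
  have h8 : k - l = 0 := by omega
  rw [h8] at h1
  ext
  omega

/-- If the nonzero terms of a finite sum have pairwise distinct valuations, then no cancellation
takes place. -/
theorem Valuation.le_map_sum_of_injOn {R Γ ι : Type*} [Ring R]
    [LinearOrderedCommGroupWithZero Γ] (v : Valuation R Γ) {s : Finset ι} {f : ι → R}
    (h : ∀ i ∈ s, ∀ j ∈ s, v (f i) ≠ 0 → v (f i) = v (f j) → i = j) {i : ι} (hi : i ∈ s) :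
    v (f i) ≤ v (∑ j ∈ s, f j) := by
  classical
  obtain ⟨j, hj, hmax⟩ := s.exists_max_image (fun i => v (f i)) ⟨i, hi⟩
  rcases eq_or_ne (v (f j)) 0 with h0 | h0
  · exact (hmax i hi).trans (h0 ▸ zero_le)
  · rw [v.map_sum_eq_of_lt hj]
    · exact hmax i hi
    · intro k hk
      rw [Finset.mem_sdiff, Finset.mem_singleton] at hk
      exact lt_of_le_of_ne (hmax k hk.1) fun e => hk.2 (h j hj k hk.1 h0 e.symm).symm

end Values

/-! ### Expansions in powers of a uniformizer. -/

section Expansion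

variable {K L : Type*} [Field K] [Field L] [Algebra K L]

theorem val_mul_pow_inj {v : Valuation L ℤᵐ⁰} {π : L} (hπ : v π = WithZero.exp (-1)) {s : ℕ}
    {b : Fin s → L} (hb : ∀ i, b i ≠ 0 → ∃ k : ℤ, v (b i) = WithZero.exp (s * k)) (i j : Fin s)
    (h0 : v (b i * π ^ (i : ℕ)) ≠ 0) (h : v (b i * π ^ (i : ℕ)) = v (b j * π ^ (j : ℕ))) :
    i = j := by
  have hi : b i ≠ 0 := by rintro e; simp [e] at h0
  have hj : b j ≠ 0 := by rintro e; rw [h] at h0; simp [e] at h0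
  obtain ⟨k, hk⟩ := hb i hi
  obtain ⟨l, hl⟩ := hb j hj
  simp only [map_mul, map_pow, hk, hl, hπ, WithZero.exp_pow_eq, WithZero.exp_mul_exp,
    WithZero.exp_inj] at h
  exact Fin.eq_of_mul_sub_eq (k := k) (l := l) (by linarith)

/-- The terms have valuations in distinct classes modulo `s`, so nothing cancels. Hence the `s`
powers of `π` are independent and, by dimension, form a basis. Used both over `M` and over the fixed
field of `W`. -/
theorem exists_expansion {s : ℕ} [FiniteDimensional K L] (hs : Module.finrank K L = s)
    {v : Valuation L ℤᵐ⁰} {π : L} (hπ : v π = WithZero.exp (-1))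
    (hK : ∀ b : K, b ≠ 0 → ∃ k : ℤ, v (algebraMap K L b) = WithZero.exp (s * k)) (x : L) :
    ∃ b : Fin s → K, x = ∑ i, algebraMap K L (b i) * π ^ (i : ℕ) ∧
      ∀ i, v (algebraMap K L (b i) * π ^ (i : ℕ)) ≤ v x := by
  subst hs
  have key : ∀ (b : Fin (Module.finrank K L) → K) (i : Fin (Module.finrank K L)),
      v (algebraMap K L (b i) * π ^ (i : ℕ)) ≤
        v (∑ i, algebraMap K L (b i) * π ^ (i : ℕ)) := by
    intro b i
    refine v.le_map_sum_of_injOn (f := fun i => algebraMap K L (b i) * π ^ (i : ℕ)) ?_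
      (Finset.mem_univ i)
    intro i _ j _
    exact val_mul_pow_inj (b := fun i => algebraMap K L (b i)) hπ
      (fun i hi => hK (b i) (by rintro e; simp [e] at hi)) i j
  have hπ0 : π ≠ 0 := by rintro rfl; exact WithZero.exp_ne_zero (hπ.symm.trans (map_zero _))
  have hli : LinearIndependent K fun i : Fin (Module.finrank K L) => π ^ (i : ℕ) := by
    rw [Fintype.linearIndependent_iff]
    intro b hb i
    have h := key b i
    simp only [← Algebra.smul_def, hb, map_zero, le_zero_iff, map_eq_zero] at h
    simpa [hπ0] using h
  have hspan := hli.span_eq_top_of_card_eq_finrank' (by simp)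
  obtain ⟨b, hb⟩ := (Submodule.mem_span_range_iff_exists_fun K).1
    (hspan ▸ Submodule.mem_top : x ∈ _)
  have hx : x = ∑ i, algebraMap K L (b i) * π ^ (i : ℕ) := by
    simp only [← Algebra.smul_def, hb]
  exact ⟨b, hx, fun i => (key b i).trans_eq (by rw [← hx])⟩

end Expansion

/-! ### Galois action and valuations in a totally ramified extension. -/

section TotallyRamified

variable {M L : Type*} [Field M] [Field L] [Algebra M L] [Valued M ℤᵐ⁰] [Valued L ℤᵐ⁰]

theorem exists_val_eq_exp_neg_one [IsCompleteLocalField L] :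
    ∃ π : L, Valued.v π = WithZero.exp (-1 : ℤ) :=
  IsCompleteLocalField.surjective _

namespace IsTotallyRamified

theorem exists_val_algebraMap (htot : IsTotallyRamified M L) (b : M) (hb : b ≠ 0) :
    ∃ k : ℤ, (Valued.v (algebraMap M L b) : ℤᵐ⁰) = WithZero.exp (Module.finrank M L * k) := by
  obtain ⟨k, hk⟩ := WithZero.eq_exp_log ((Valuation.ne_zero_iff Valued.v).2 hb)
  exact ⟨k, by rw [htot, hk, WithZero.exp_pow_eq]⟩

variable [FiniteDimensional M L]

theorem val_algebraMap_le_one (htot : IsTotallyRamified M L) {b : M} :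
    (Valued.v (algebraMap M L b) : ℤᵐ⁰) ≤ 1 ↔ (Valued.v b : ℤᵐ⁰) ≤ 1 := by
  rw [htot, pow_le_one_iff Module.finrank_pos.ne']

theorem exists_integral_expansion (htot : IsTotallyRamified M L) {π : L}
    (hπ : Valued.v π = WithZero.exp (-1 : ℤ)) {x : L} (hx : (Valued.v x : ℤᵐ⁰) ≤ 1) :
    ∃ b : Fin (Module.finrank M L) → M, x = ∑ i, algebraMap M L (b i) * π ^ (i : ℕ) ∧
      ∀ i, (Valued.v (algebraMap M L (b i)) : ℤᵐ⁰) ≤ 1 := by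
  obtain ⟨b, hb, hv⟩ := exists_expansion rfl hπ htot.exists_val_algebraMap x
  refine ⟨b, hb, fun i => ?_⟩
  rcases eq_or_ne (b i) 0 with h0 | h0
  · simp [h0]
  obtain ⟨k, hk⟩ := htot.exists_val_algebraMap _ h0
  have h := (hv i).trans hx
  rw [map_mul, map_pow, hk, hπ, WithZero.exp_pow_eq, WithZero.exp_mul_exp, ← WithZero.exp_zero,
    WithZero.exp_le_exp] at h
  rw [hk, ← WithZero.exp_zero, WithZero.exp_le_exp]
  have hi := i.2
  have h1 : (Module.finrank M L : ℤ) * k < Module.finrank M L := by omega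
  have h2 : k < 1 := by nlinarith
  nlinarith

/-- By the integral expansion, the values of `σ` on the valuation ring are bounded by the largest `v
(σ π ^ j)`. An integral `x` with `v (σ x) > 1` would have powers violating this bound. -/
theorem val_apply_le_one [IsCompleteLocalField L] (htot : IsTotallyRamified M L) (σ : Gal(L/M))
    {x : L} (hx : (Valued.v x : ℤᵐ⁰) ≤ 1) : (Valued.v (σ x) : ℤᵐ⁰) ≤ 1 := by
  obtain ⟨π, hπ⟩ := exists_val_eq_exp_neg_one (L := L)
  have hne : (Finset.univ : Finset (Fin (Module.finrank M L))).Nonempty :=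
    ⟨⟨0, Module.finrank_pos⟩, Finset.mem_univ _⟩
  obtain ⟨j, -, hj⟩ := Finset.univ.exists_max_image
    (fun i : Fin (Module.finrank M L) => (Valued.v (σ π ^ (i : ℕ)) : ℤᵐ⁰)) hne
  have hbound : ∀ y : L, (Valued.v y : ℤᵐ⁰) ≤ 1 →
      (Valued.v (σ y) : ℤᵐ⁰) ≤ Valued.v (σ π ^ (j : ℕ)) := by
    intro y hy
    obtain ⟨b, rfl, hb⟩ := htot.exists_integral_expansion hπ hy
    rw [map_sum]
    refine Valuation.map_sum_le _ fun i _ => ?_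
    rw [map_mul, AlgEquiv.commutes, map_pow, map_mul]
    exact (mul_le_mul' (hb i) (hj i (Finset.mem_univ i))).trans_eq (one_mul _)
  by_contra! hlt
  obtain ⟨k, hk⟩ := MulArchimedean.arch (Valued.v (σ π ^ (j : ℕ)) : ℤᵐ⁰) hlt
  have h := hbound (x ^ (k + 1)) (by rw [map_pow]; exact pow_le_one₀ zero_le hx)
  rw [map_pow σ, map_pow Valued.v (σ x)] at h
  exact absurd (h.trans hk) (not_le.2 (pow_lt_pow_right₀ hlt k.lt_succ_self))

theorem val_apply [IsCompleteLocalField M] [IsCompleteLocalField L]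
    (htot : IsTotallyRamified M L) (σ : Gal(L/M)) (x : L) :
    (Valued.v (σ x) : ℤᵐ⁰) = Valued.v x := by
  have key : ∀ (τ : Gal(L/M)) (y : L), (Valued.v (τ y) : ℤᵐ⁰) ≤ Valued.v y := by
    intro τ y
    rcases eq_or_ne y 0 with rfl | hy
    · simp
    have hvy : (Valued.v y : ℤᵐ⁰) ≠ 0 := (Valuation.ne_zero_iff Valued.v).2 hy
    -- Total ramification gives `y ^ N` the same valuation as this `b` from `M`, which `τ` fixes;
    -- the integral case then applies to their quotient.
    obtain ⟨b, hb⟩ := IsCompleteLocalField.surjective (K := M) (Valued.v y)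
    have h := htot.val_apply_le_one τ (x := y ^ Module.finrank M L * (algebraMap M L b)⁻¹)
      (by rw [map_mul, map_inv₀, map_pow, htot, hb, mul_inv_cancel₀ (pow_ne_zero _ hvy)])
    rw [map_mul, map_inv₀, map_pow, AlgEquiv.commutes, map_mul, map_inv₀, map_pow, htot, hb,
      mul_inv_le_iff₀ (pow_pos (zero_lt_iff.2 hvy) _), one_mul] at h
    exact (pow_le_pow_iff_left₀ zero_le zero_le Module.finrank_pos.ne').1 h
  refine le_antisymm (key σ x) ?_
  simpa using key σ⁻¹ (σ x)

theorem val_eq_val_norm [IsCompleteLocalField M] [IsCompleteLocalField L] [IsGalois M L]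
    (htot : IsTotallyRamified M L) (x : L) :
    (Valued.v x : ℤᵐ⁰) = Valued.v (Algebra.norm M x) := by
  have h := htot (Algebra.norm M x)
  rw [Algebra.norm_eq_prod_automorphisms, map_prod] at h
  simp only [htot.val_apply, Finset.prod_const, Finset.card_univ] at h
  rw [← Nat.card_eq_fintype_card, IsGalois.card_aut_eq_finrank] at h
  exact (pow_left_inj₀ zero_le zero_le Module.finrank_pos.ne').1 h

/-- The value group of the fixed field of `H` is contained in `|H| ℤ`. -/
theorem exists_val_fixedField [IsCompleteLocalField M] [IsCompleteLocalField L] [IsGalois M L]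
    (htot : IsTotallyRamified M L) (H : Subgroup Gal(L/M)) {x : L}
    (hx : x ∈ IntermediateField.fixedField H) (h0 : x ≠ 0) :
    ∃ k : ℤ, (Valued.v x : ℤᵐ⁰) = WithZero.exp (Nat.card H * k) := by
  have h1 := htot.val_eq_val_norm x
  have h2 : Algebra.norm M x =
      Algebra.norm M (⟨x, hx⟩ : IntermediateField.fixedField H) ^ Nat.card H := by
    rw [← IntermediateField.finrank_fixedField_eq_card, ← map_pow, ← Algebra.norm_algebraMap,
      Algebra.norm_norm]
    rfl
  have h3 : Algebra.norm M (⟨x, hx⟩ : IntermediateField.fixedField H) ≠ 0 := by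
    rw [Algebra.norm_ne_zero_iff]
    exact fun e => h0 (congrArg Subtype.val e)
  obtain ⟨k, hk⟩ := WithZero.eq_exp_log ((Valuation.ne_zero_iff Valued.v).2 h3)
  exact ⟨k, by rw [h1, h2, map_pow, hk, WithZero.exp_pow_eq]⟩

/-- The norm from `L` to the fixed field of `H` of a uniformizer. -/
theorem exists_mem_fixedField_val [IsCompleteLocalField M] [IsCompleteLocalField L]
    (htot : IsTotallyRamified M L) (H : Subgroup Gal(L/M)) :
    ∃ x ∈ IntermediateField.fixedField H,
      (Valued.v x : ℤᵐ⁰) = WithZero.exp (-(Nat.card H : ℤ)) := by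
  classical
  have := Fintype.ofFinite H
  obtain ⟨π, hπ⟩ := exists_val_eq_exp_neg_one (L := L)
  refine ⟨∏ τ : H, τ.1 π, ?_, ?_⟩
  · rw [IntermediateField.mem_fixedField_iff]
    intro f hf
    rw [map_prod]
    exact Fintype.prod_equiv (Equiv.mulLeft (⟨f, hf⟩ : H)) _ _ fun τ => rfl
  · rw [map_prod]
    simp only [htot.val_apply, hπ, Finset.prod_const, Finset.card_univ, WithZero.exp_pow_eq,
      ← Nat.card_eq_fintype_card]
    congr 1
    ring

/-- The value group of the fixed field lies in |H|ℤ, and the norm of a uniformizer of `L` attains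
|H|. -/
theorem val_uniformizer_fixedField [IsCompleteLocalField M] [IsCompleteLocalField L] [IsGalois M L]
    (htot : IsTotallyRamified M L) (H : Subgroup Gal(L/M)) {π : IntermediateField.fixedField H}
    (hπ : IsUniformizerFor
      (Valued.v.comap (algebraMap (IntermediateField.fixedField H) L)) π) :
    (Valued.v (π : L) : ℤᵐ⁰) = WithZero.exp (-(Nat.card H : ℤ)) := by
  have hpos : (0 : ℤ) < Nat.card H := by exact_mod_cast Nat.card_pos
  obtain ⟨x, hx, hv⟩ := htot.exists_mem_fixedField_val H
  have h1 : (Valued.v x : ℤᵐ⁰) ≤ Valued.v (π : L) := by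
    refine (hπ.2 ⟨x, hx⟩).1 ?_
    change (Valued.v x : ℤᵐ⁰) < 1
    rw [hv, ← WithZero.exp_zero, WithZero.exp_lt_exp]
    omega
  have h2 : (Valued.v (π : L) : ℤᵐ⁰) < 1 := (hπ.2 π).2 le_rfl
  obtain ⟨k, hk⟩ := htot.exists_val_fixedField H π.2
    (fun e => hπ.1 (Subtype.ext e))
  rw [hk, ← WithZero.exp_zero, WithZero.exp_lt_exp] at h2
  rw [hk, hv, WithZero.exp_le_exp] at h1
  have h3 : k < 0 := by nlinarith
  have h4 : -1 ≤ k := by nlinarith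
  have h5 : k = -1 := by omega
  rw [hk, h5, mul_neg_one]

/-- The residue field extension is trivial. -/
theorem exists_residue_eq [IsCompleteLocalField L] (htot : IsTotallyRamified M L) {x : L}
    (hx : (Valued.v x : ℤᵐ⁰) ≤ 1) :
    ∃ a : M, (Valued.v a : ℤᵐ⁰) ≤ 1 ∧ (Valued.v (x - algebraMap M L a) : ℤᵐ⁰) < 1 := by
  obtain ⟨π, hπ⟩ := exists_val_eq_exp_neg_one (L := L)
  obtain ⟨b, rfl, hb⟩ := htot.exists_integral_expansion hπ hx
  have hN : 0 < Module.finrank M L := Module.finrank_pos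
  refine ⟨b ⟨0, hN⟩, htot.val_algebraMap_le_one.1 (hb _), ?_⟩
  have h : algebraMap M L (b ⟨0, hN⟩) = ∑ i : Fin (Module.finrank M L),
      if i = ⟨0, hN⟩ then algebraMap M L (b i) * π ^ (i : ℕ) else 0 := by
    simp
  rw [h, ← Finset.sum_sub_distrib]
  refine Valuation.map_sum_lt _ one_ne_zero fun i _ => ?_
  split_ifs with hi
  · simp
  · rw [sub_zero, map_mul, map_pow, hπ, WithZero.exp_pow_eq]
    refine (mul_le_mul' (hb i) le_rfl).trans_lt ?_
    rw [one_mul, ← WithZero.exp_zero, WithZero.exp_lt_exp]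
    have : (i : ℕ) ≠ 0 := fun e => hi (Fin.ext e)
    omega

theorem val_apply_sub_lt_one [IsCompleteLocalField M] [IsCompleteLocalField L]
    (htot : IsTotallyRamified M L) (σ : Gal(L/M)) {x : L} (hx : (Valued.v x : ℤᵐ⁰) ≤ 1) :
    (Valued.v (σ x - x) : ℤᵐ⁰) < 1 := by
  obtain ⟨a, -, ha⟩ := htot.exists_residue_eq hx
  have h : σ x - x = σ (x - algebraMap M L a) - (x - algebraMap M L a) := by
    rw [map_sub, AlgEquiv.commutes]
    ring
  rw [h]
  exact Valuation.map_sub_lt _ (by rwa [htot.val_apply]) ha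

/-- The displacement of a uniformizer bounds the displacement of every integer. -/
theorem val_apply_sub_le [IsCompleteLocalField M] [IsCompleteLocalField L]
    (htot : IsTotallyRamified M L) (σ : Gal(L/M)) {π : L} (hπ : Valued.v π = WithZero.exp (-1 : ℤ))
    {x : L} (hx : (Valued.v x : ℤᵐ⁰) ≤ 1) :
    (Valued.v (σ x - x) : ℤᵐ⁰) ≤ Valued.v (σ π - π) := by
  obtain ⟨b, rfl, hb⟩ := htot.exists_integral_expansion hπ hx
  have hπ1 : (Valued.v π : ℤᵐ⁰) ≤ 1 := by
    rw [hπ, ← WithZero.exp_zero, WithZero.exp_le_exp]; omega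
  rw [map_sum, ← Finset.sum_sub_distrib]
  refine Valuation.map_sum_le _ fun i _ => ?_
  rw [map_mul, AlgEquiv.commutes, map_pow, ← mul_sub, map_mul, ← Commute.mul_geom_sum₂ (.all _ _),
    map_mul, mul_left_comm]
  refine mul_le_of_le_one_right' (mul_le_one' (hb i) ?_)
  refine Valuation.map_sum_le _ fun j _ => ?_
  rw [map_mul, map_pow, map_pow, htot.val_apply]
  exact mul_le_one' (pow_le_one₀ zero_le hπ1) (pow_le_one₀ zero_le hπ1)

end IsTotallyRamified
end TotallyRamified

/-! ### Residue characteristic. -/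

section ResidueField

variable {K : Type*} [Field K] [Valued K ℤᵐ⁰]

theorem Valued.residue_eq_zero_iff_val_lt_one (r : 𝒪[K]) :
    IsLocalRing.residue 𝒪[K] r = 0 ↔ (Valued.v (r : K) : ℤᵐ⁰) < 1 := by
  rw [IsLocalRing.residue_eq_zero_iff, IsLocalRing.mem_maximalIdeal, mem_nonunits_iff,
    Valuation.Integers.isUnit_iff_valuation_eq_one (Valuation.integer.integers Valued.v)]
  exact ⟨fun h => lt_of_le_of_ne r.2 h, fun h => h.ne⟩

theorem Valued.exists_prime_charP_residue [Finite 𝓀[K]] :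
    ∃ p : ℕ, p.Prime ∧ CharP 𝓀[K] p ∧ (Valued.v (p : K) : ℤᵐ⁰) < 1 := by
  obtain ⟨p, hp⟩ := CharP.exists 𝓀[K]
  refine ⟨p, (CharP.char_is_prime_or_zero 𝓀[K] p).resolve_right fun h => ?_, hp, ?_⟩
  · subst h
    exact CharP.char_ne_zero_of_finite 𝓀[K] 0 rfl
  · have h : IsLocalRing.residue 𝒪[K] (p : 𝒪[K]) = 0 := by
      rw [map_natCast, CharP.cast_eq_zero]
    simpa using (Valued.residue_eq_zero_iff_val_lt_one _).1 h

theorem Valued.val_natCast_le_one (m : ℕ) : (Valued.v (m : K) : ℤᵐ⁰) ≤ 1 := by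
  induction m with
  | zero => simp
  | succ m ih =>
    rw [Nat.cast_succ]
    exact (Valuation.map_add _ _ _).trans (max_le ih (by simp))

end ResidueField

/-! ### Wild inertia in the weakly ramified case. -/

section RamificationGroups

variable {M L : Type*} [Field M] [Field L] [Algebra M L] [Valued L ℤᵐ⁰]
  [FiniteDimensional M L]

theorem mem_ramificationGroup_one_iff (σ : Gal(L/M)) :
    σ ∈ ramificationGroup M L 1 ↔
      ∀ x : L, (Valued.v x : ℤᵐ⁰) ≤ 1 → (Valued.v (σ x - x) : ℤᵐ⁰) ≤ WithZero.exp (-2) :=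
  Iff.rfl

theorem mem_ramificationGroup_two_iff (σ : Gal(L/M)) :
    σ ∈ ramificationGroup M L 2 ↔
      ∀ x : L, (Valued.v x : ℤᵐ⁰) ≤ 1 → (Valued.v (σ x - x) : ℤᵐ⁰) ≤ WithZero.exp (-3) :=
  Iff.rfl

variable [Valued M ℤᵐ⁰]

namespace IsTotallyRamified

theorem val_natCast_lt_one (htot : IsTotallyRamified M L) {p : ℕ}
    (hp : (Valued.v (p : M) : ℤᵐ⁰) < 1) : (Valued.v (p : L) : ℤᵐ⁰) < 1 := by
  rw [← map_natCast (algebraMap M L), htot]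
  exact pow_lt_one₀ zero_le hp Module.finrank_pos.ne'

theorem charP_residue (htot : IsTotallyRamified M L) {p : ℕ} (hp : p.Prime)
    (hpM : (Valued.v (p : M) : ℤᵐ⁰) < 1) : CharP 𝓀[L] p := by
  rw [CharP.charP_iff_prime_eq_zero hp, ← map_natCast (IsLocalRing.residue 𝒪[L]),
    Valued.residue_eq_zero_iff_val_lt_one]
  simpa using htot.val_natCast_lt_one hpM

theorem val_natCast_eq_one (htot : IsTotallyRamified M L) {p : ℕ} (hp : p.Prime)
    (hpM : (Valued.v (p : M) : ℤᵐ⁰) < 1) {m : ℕ} (hm : ¬ p ∣ m) :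
    (Valued.v (m : L) : ℤᵐ⁰) = 1 := by
  have := htot.charP_residue hp hpM
  refine le_antisymm (Valued.val_natCast_le_one m) (not_lt.1 fun h => hm ?_)
  have h1 := (Valued.residue_eq_zero_iff_val_lt_one (m : 𝒪[L])).2 (by simpa using h)
  rw [map_natCast] at h1
  exact (CharP.cast_eq_zero_iff 𝓀[L] p m).1 h1

variable [IsCompleteLocalField M] [IsCompleteLocalField L]

/-- A smaller displacement of `π` would bound the displacement of every integer and put `σ` in G_2.
-/
theorem val_apply_sub_eq (htot : IsTotallyRamified M L) (hweak : IsWeaklyRamified M L)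
    {σ : Gal(L/M)} (hσ : σ ∈ ramificationGroup M L 1) (h1 : σ ≠ 1) {π : L}
    (hπ : Valued.v π = WithZero.exp (-1 : ℤ)) :
    (Valued.v (σ π - π) : ℤᵐ⁰) = WithZero.exp (-2) := by
  have hπ1 : (Valued.v π : ℤᵐ⁰) ≤ 1 := by
    rw [hπ, ← WithZero.exp_zero, WithZero.exp_le_exp]; omega
  refine le_antisymm ((mem_ramificationGroup_one_iff σ).1 hσ π hπ1) ?_
  by_contra! hlt
  refine h1 ((Subgroup.mem_bot).1 (hweak ▸ (mem_ramificationGroup_two_iff σ).2 fun x hx => ?_))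
  exact (htot.val_apply_sub_le σ hπ hx).trans (WithZero.lt_exp_iff_le_exp_sub_one.1 hlt)

theorem val_apply_sub_le_of_mem (htot : IsTotallyRamified M L)
    {σ : Gal(L/M)} (hσ : σ ∈ ramificationGroup M L 1) {x : L}
    (hx : (Valued.v x : ℤᵐ⁰) ≤ WithZero.exp (-2)) :
    (Valued.v (σ x - x) : ℤᵐ⁰) ≤ WithZero.exp (-3) := by
  obtain ⟨π, hπ⟩ := exists_val_eq_exp_neg_one (L := L)
  have hπ0 : π ≠ 0 := by rintro rfl; exact WithZero.exp_ne_zero (hπ.symm.trans (map_zero _))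
  have hπ1 : (Valued.v π : ℤᵐ⁰) ≤ 1 := by
    rw [hπ, ← WithZero.exp_zero, WithZero.exp_le_exp]; omega
  rw [mem_ramificationGroup_one_iff] at hσ
  have hz : (Valued.v (x / π) : ℤᵐ⁰) ≤ WithZero.exp (-1) := by
    rw [map_div₀, hπ, div_eq_mul_inv, ← WithZero.exp_neg, WithZero.mul_exp_le_exp_iff]
    exact hx
  -- Product rule for `σ - 1` applied to x = π · (x / π).
  have e : σ x - x = σ π * (σ (x / π) - x / π) + (σ π - π) * (x / π) := by
    have : x = π * (x / π) := by field_simp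
    nth_rw 1 [this]
    rw [map_mul]
    field_simp
    ring
  rw [e]
  refine (Valuation.map_add _ _ _).trans (max_le ?_ ?_)
  · rw [map_mul, htot.val_apply, hπ]
    refine (mul_le_mul' le_rfl (hσ _ (hz.trans ?_))).trans_eq (WithZero.exp_mul_exp)
    rw [← WithZero.exp_zero, WithZero.exp_le_exp]; omega
  · rw [map_mul]
    exact (mul_le_mul' (hσ _ hπ1) hz).trans_eq (WithZero.exp_mul_exp)

/-- In a weakly ramified extension the wild inertia group has exponent `p`. -/
theorem pow_prime_eq_one (htot : IsTotallyRamified M L) (hweak : IsWeaklyRamified M L)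
    {p : ℕ} (hpM : (Valued.v (p : M) : ℤᵐ⁰) < 1)
    {σ : Gal(L/M)} (hσ : σ ∈ ramificationGroup M L 1) : σ ^ p = 1 := by
  refine (Subgroup.mem_bot).1 (hweak ▸ (mem_ramificationGroup_two_iff _).2 fun x hx => ?_)
  have hpL : (Valued.v (p : L) : ℤᵐ⁰) ≤ WithZero.exp (-1) :=
    WithZero.lt_one_iff_le_exp_neg_one.1 (htot.val_natCast_lt_one hpM)
  -- With D = σ - 1, expand σ^p - 1 binomially. The linear term p·D lands in 𝔓^3 because p ∈ 𝔓, the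
  -- others because D² already does; so σ^p ∈ G_2.
  let D : Module.End M L := (σ : L →ₐ[M] L).toLinearMap - 1
  have hD : ∀ y, D y = σ y - y := fun y => rfl
  have hD1 : (Valued.v (D x) : ℤᵐ⁰) ≤ WithZero.exp (-2) :=
    (mem_ramificationGroup_one_iff σ).1 hσ x hx
  have hD2 : ∀ j : ℕ, (Valued.v ((D ^ (j + 2)) x) : ℤᵐ⁰) ≤ WithZero.exp (-3) := by
    intro j
    induction j with
    | zero => exact htot.val_apply_sub_le_of_mem hσ hD1
    | succ j ih =>
      rw [show j + 1 + 2 = (j + 2) + 1 by ring, pow_succ', Module.End.mul_apply]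
      exact htot.val_apply_sub_le_of_mem hσ (ih.trans (WithZero.exp_le_exp.2 (by omega)))
  have hpow : ∀ (k : ℕ) (y : L), (σ ^ k) y = ((D + 1) ^ k) y := by
    intro k
    induction k with
    | zero => intro y; rfl
    | succ k ih =>
      intro y
      rw [pow_succ', pow_succ', AlgEquiv.mul_apply, Module.End.mul_apply, ih,
        LinearMap.add_apply, hD, Module.End.one_apply]
      ring
  have hsum : (σ ^ p) x - x =
      ∑ m ∈ Finset.range p, (p.choose (m + 1) : L) * (D ^ (m + 1)) x := by
    rw [hpow, (Commute.one_right D).add_pow, LinearMap.sum_apply, Finset.sum_range_succ']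
    simp only [one_pow, mul_one, pow_zero, Nat.choose_zero_right, Nat.cast_one,
      Module.End.one_apply, add_sub_cancel_right]
    refine Finset.sum_congr rfl fun m _ => ?_
    rw [← Nat.cast_comm, Module.End.mul_apply, ← nsmul_eq_mul]
    exact Module.End.natCast_apply _ _
  rw [hsum]
  refine Valuation.map_sum_le _ fun m hm => ?_
  rw [map_mul]
  rcases m with _ | m
  · rw [zero_add, pow_one, Nat.choose_one_right]
    exact (mul_le_mul' hpL hD1).trans_eq (WithZero.exp_mul_exp)
  · exact (mul_le_mul' (Valued.val_natCast_le_one _) (hD2 m)).trans_eq (one_mul _)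

theorem isPGroup_ramificationGroup_one (htot : IsTotallyRamified M L)
    (hweak : IsWeaklyRamified M L) {p : ℕ}
    (hpM : (Valued.v (p : M) : ℤᵐ⁰) < 1) : IsPGroup p (ramificationGroup M L 1) :=
  fun σ => ⟨1, Subtype.ext (by simpa using htot.pow_prime_eq_one hweak hpM σ.2)⟩

/-- An automorphism of `p`-power order is wildly ramified. -/
theorem mem_ramificationGroup_one_of_pow_prime (htot : IsTotallyRamified M L)
    {p : ℕ} (hp : p.Prime) [CharP 𝓀[L] p]
    {σ : Gal(L/M)} (hσ : σ ^ p = 1) : σ ∈ ramificationGroup M L 1 := by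
  have := Fact.mk hp
  obtain ⟨π, hπ⟩ := exists_val_eq_exp_neg_one (L := L)
  have hπ0 : π ≠ 0 := by rintro rfl; exact WithZero.exp_ne_zero (hπ.symm.trans (map_zero _))
  have hε1 : (Valued.v (σ π / π) : ℤᵐ⁰) = 1 := by
    rw [map_div₀, htot.val_apply, div_self ((Valuation.ne_zero_iff _).2 hπ0)]
  let ε : 𝒪[L] := ⟨σ π / π, hε1.le⟩
  let act : ℕ → 𝒪[L] := fun k => ⟨(σ ^ k) π / π, by
    rw [Valuation.mem_integer_iff, map_div₀, htot.val_apply,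
      div_self ((Valuation.ne_zero_iff _).2 hπ0)]⟩
  -- Inertia acts trivially on residues, so the cocycle k ↦ σ^k π / π becomes multiplicative there.
  -- The residue of ε is then a p-th root of 1 in characteristic p, hence 1.
  have hact : ∀ k, IsLocalRing.residue 𝒪[L] (act k) = IsLocalRing.residue 𝒪[L] ε ^ k := by
    intro k
    induction k with
    | zero =>
      have : act 0 = 1 := Subtype.ext (by simp [act, hπ0])
      rw [this, map_one, pow_zero]
    | succ k ih =>
      rw [pow_succ, ← ih, ← map_mul, ← sub_eq_zero, ← map_sub,
        Valued.residue_eq_zero_iff_val_lt_one]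
      have e : ((act (k + 1) - act k * ε : 𝒪[L]) : L) =
          (act k : L) * ((σ ^ k) (ε : L) - ε) := by
        change (σ ^ (k + 1)) π / π - (σ ^ k) π / π * (σ π / π) =
          (σ ^ k) π / π * ((σ ^ k) (σ π / π) - σ π / π)
        rw [pow_succ, AlgEquiv.mul_apply, map_div₀]
        have : (σ ^ k) π ≠ 0 := (map_ne_zero _).2 hπ0
        field_simp
      rw [e, map_mul]
      exact mul_lt_one_of_nonneg_of_lt_one_right (act k).2 zero_le
        (htot.val_apply_sub_lt_one _ hε1.le)
  have h1 : IsLocalRing.residue 𝒪[L] (ε - 1) = 0 := by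
    have h := hact p
    have hp1 : act p = 1 := Subtype.ext (by simp [act, hσ, hπ0])
    rw [hp1, map_one] at h
    have h2 : (IsLocalRing.residue 𝒪[L] ε - 1) ^ p = 0 := by
      rw [sub_pow_char, ← h, one_pow, sub_self]
    rw [map_sub, map_one]
    exact pow_eq_zero_iff hp.ne_zero |>.1 h2
  rw [Valued.residue_eq_zero_iff_val_lt_one] at h1
  rw [mem_ramificationGroup_one_iff]
  intro x hx
  refine (htot.val_apply_sub_le σ hπ hx).trans ?_
  have e : σ π - π = (ε - 1 : 𝒪[L]) * π := by
    change σ π - π = (σ π / π - 1) * π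
    field_simp
  rw [e, map_mul, hπ]
  exact (mul_le_mul' (WithZero.lt_one_iff_le_exp_neg_one.1 h1) le_rfl).trans_eq
    WithZero.exp_mul_exp

/-- The order of a complement of the wild inertia group is prime to `p`. -/
theorem not_dvd_card_of_disjoint (htot : IsTotallyRamified M L) {p : ℕ} (hp : p.Prime)
    (hpM : (Valued.v (p : M) : ℤᵐ⁰) < 1) {C : Subgroup Gal(L/M)}
    (hC : Disjoint (ramificationGroup M L 1) C) : ¬ p ∣ Nat.card C := by
  intro h
  have := Fact.mk hp
  have := htot.charP_residue hp hpM
  obtain ⟨g, hg⟩ := exists_prime_orderOf_dvd_card' p h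
  have h1 : (g : Gal(L/M)) ^ p = 1 := by
    rw [← Subgroup.coe_pow, ← hg, pow_orderOf_eq_one, Subgroup.coe_one]
  have h2 := htot.mem_ramificationGroup_one_of_pow_prime hp h1
  have h3 : g = 1 := Subtype.ext (Subgroup.disjoint_def.1 hC h2 g.2)
  rw [h3, orderOf_one] at hg
  exact hp.one_lt.ne hg

end IsTotallyRamified
end RamificationGroups

/-! ### The exact valuation of the wild trace. -/

section WildTrace

variable {M L : Type*} [Field M] [Field L] [Algebra M L] [Valued M ℤᵐ⁰] [Valued L ℤᵐ⁰]
  [IsCompleteLocalField M] [IsCompleteLocalField L] [FiniteDimensional M L] [IsGalois M L]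

namespace IsTotallyRamified

/-- The exact valuation of the trace to the fixed field of the wild inertia group, in a weakly
ramified extension, of an element whose valuation is `1` modulo the order of that group. -/
theorem val_sum_ramificationGroup_one (htot : IsTotallyRamified M L)
    (hweak : IsWeaklyRamified M L) {W : Subgroup Gal(L/M)} (hW : W = ramificationGroup M L 1)
    [Fintype W] {m : ℤ} {x : L} (hx : (Valued.v x : ℤᵐ⁰) = WithZero.exp (-(1 + m * Nat.card W))) :
    (Valued.v (∑ w : W, w.1 x) : ℤᵐ⁰) = WithZero.exp (-((m + 1) * Nat.card W)) := by
  classical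
  set q := Nat.card W with hq
  have hqpos : 0 < q := Nat.card_pos
  obtain ⟨π, hπ⟩ := exists_val_eq_exp_neg_one (L := L)
  obtain ⟨e₀, he₀, hve₀⟩ := htot.exists_mem_fixedField_val W
  have hdist : ∀ w w' : W, w' ≠ w → (Valued.v (w.1 π - w'.1 π) : ℤᵐ⁰) = WithZero.exp (-2) := by
    intro w w' hne
    have h := htot.val_apply_sub_eq hweak (σ := (w'⁻¹ * w).1) (hW ▸ (w'⁻¹ * w).2)
      (fun h => hne (inv_mul_eq_one.1 (Subtype.ext h))) hπ
    rw [← h, ← htot.val_apply w'.1 ((w'⁻¹ * w).1 π - π), map_sub w'.1,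
      ← AlgEquiv.mul_apply, ← Subgroup.coe_mul, mul_inv_cancel_left]
  have hinj : Set.InjOn (fun w : W => w.1 π) (Finset.univ : Finset W) := by
    intro w _ w' _ h
    by_contra hne
    have := hdist w w' (Ne.symm hne)
    rw [sub_eq_zero.2 h, map_zero] at this
    exact WithZero.exp_ne_zero this.symm
  -- `D w` is the derivative at w(π) of the minimal polynomial of π over the fixed field. By weak
  -- ramification each of its q - 1 factors has additive valuation 2.
  let D : W → L := fun w => ∏ w' ∈ Finset.univ.erase w, (w.1 π - w'.1 π)
  have hD : ∀ w, D w = w.1 (D 1) := by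
    intro w
    simp only [D, map_prod]
    refine (Finset.prod_bij (fun w' _ => w * w') ?_ ?_ ?_ ?_).symm
    · intro w' hw'
      simpa using hw'
    · intro a _ b _ h
      exact mul_left_cancel h
    · intro b hb
      refine ⟨w⁻¹ * b, ?_, by simp⟩
      have hb' : b ≠ w := by simpa using hb
      simp only [Finset.mem_erase, Finset.mem_univ, and_true, ne_eq]
      exact fun h => hb' (inv_mul_eq_one.1 h).symm
    · intro w' _
      rw [map_sub, Subgroup.coe_mul, AlgEquiv.mul_apply, Subgroup.coe_one, AlgEquiv.one_apply]
  have hvD : (Valued.v (D 1) : ℤᵐ⁰) = WithZero.exp (-(2 * ((q : ℤ) - 1))) := by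
    have hcard : (Finset.univ.erase (1 : W)).card = q - 1 := by
      rw [Finset.card_erase_of_mem (Finset.mem_univ _), Finset.card_univ, hq,
        Nat.card_eq_fintype_card]
    rw [map_prod, Finset.prod_congr rfl fun w' hw' => hdist 1 w' (Finset.ne_of_mem_erase hw'),
      Finset.prod_const, hcard, WithZero.exp_pow_eq, Nat.cast_sub hqpos]
    congr 1
    push_cast
    ring
  have hD0 : ∀ w, D w ≠ 0 := by
    intro w h
    rw [hD, map_eq_zero] at h
    rw [h, map_zero] at hvD
    exact WithZero.exp_ne_zero hvD.symm
  -- This factor from the fixed field is chosen so that y = x · D 1 · z has additive valuation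
  -- exactly q - 1.
  let z : L := e₀ ^ (-(m + 1))
  have hz : z ∈ IntermediateField.fixedField W := zpow_mem he₀ _
  have hvz : (Valued.v z : ℤᵐ⁰) = WithZero.exp ((m + 1) * q) := by
    rw [map_zpow₀, hve₀, WithZero.exp_zpow_eq]
    congr 1
    ring
  have hz0 : z ≠ 0 := by
    intro h
    rw [h, map_zero] at hvz
    exact WithZero.exp_ne_zero hvz.symm
  let y : L := x * D 1 * z
  have hvy : (Valued.v y : ℤᵐ⁰) = WithZero.exp (-((q : ℤ) - 1)) := by
    rw [map_mul, map_mul, hx, hvD, hvz, WithZero.exp_mul_exp, WithZero.exp_mul_exp]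
    congr 1
    ring
  have hfin : Module.finrank (IntermediateField.fixedField W) L = q :=
    IntermediateField.finrank_fixedField_eq_card W
  obtain ⟨b, hb, hvb⟩ := exists_expansion (K := IntermediateField.fixedField W) hfin hπ
    (fun b hb0 => htot.exists_val_fixedField W b.2 fun e => hb0 (Subtype.ext e)) y
  let P : Polynomial L := ∑ i : Fin q, Polynomial.C (b i : L) * Polynomial.X ^ (i : ℕ)
  have hPdeg : P.degree < (Finset.univ : Finset W).card := by
    rw [Finset.card_univ, ← Nat.card_eq_fintype_card, ← hq, ← Polynomial.mem_degreeLT]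
    refine Submodule.sum_mem _ fun i _ => Polynomial.mem_degreeLT.2 ?_
    exact (Polynomial.degree_C_mul_X_pow_le _ _).trans_lt (by exact_mod_cast i.2)
  have hPeval : ∀ w : W, P.eval (w.1 π) = w.1 y := by
    intro w
    rw [hb, Polynomial.eval_finsetSum, map_sum]
    refine Finset.sum_congr rfl fun i _ => ?_
    rw [Polynomial.eval_mul, Polynomial.eval_C, Polynomial.eval_pow, Polynomial.eval_X, map_mul,
      map_pow]
    congr 1
    exact ((IntermediateField.mem_fixedField_iff W _).1 (b i).2 w.1 w.2).symm
  have hlast : q - 1 < q := by omega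
  have hcoeff : P.coeff (q - 1) = b ⟨q - 1, hlast⟩ := by
    simp only [P, Polynomial.finsetSum_coeff, Polynomial.coeff_C_mul_X_pow]
    rw [Finset.sum_eq_single ⟨q - 1, hlast⟩]
    · simp
    · intro i _ hi
      rw [if_neg]
      exact fun h => hi (Fin.ext h.symm)
    · simp
  -- Some term of the expansion attains the valuation q - 1 of y. Modulo q this forces the index q -
  -- 1, and then its coefficient is a unit.
  have hvlast : (Valued.v (b ⟨q - 1, hlast⟩ : L) : ℤᵐ⁰) = 1 := by
    obtain ⟨i, hi⟩ : ∃ i : Fin q, (Valued.v y : ℤᵐ⁰) ≤ Valued.v ((b i : L) * π ^ (i : ℕ)) := by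
      by_contra! hlt
      have h := Valuation.map_sum_lt (Valued.v : Valuation L ℤᵐ⁰)
        (by rw [hvy]; exact WithZero.exp_ne_zero) (fun i (_ : i ∈ Finset.univ) => hlt i)
      exact absurd (congrArg (Valued.v : Valuation L ℤᵐ⁰) hb) h.ne'
    have heq := le_antisymm (hvb i) hi
    have hb0 : (b i : L) ≠ 0 := by
      intro h
      rw [IntermediateField.algebraMap_apply, h, zero_mul, map_zero, hvy] at heq
      exact WithZero.exp_ne_zero heq.symm
    obtain ⟨k, hk⟩ := htot.exists_val_fixedField W (b i).2 hb0
    rw [IntermediateField.algebraMap_apply, map_mul, map_pow, hk, hπ, hvy, WithZero.exp_pow_eq,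
      WithZero.exp_mul_exp, WithZero.exp_inj, ← hq] at heq
    have h1 : (q : ℤ) * k < 1 * q := by have := i.2; omega
    have h2 : (q : ℤ) * (-1) < q * k := by omega
    have h3 : k = 0 := by
      have := lt_of_mul_lt_mul_left h2 (by positivity)
      have : k < 1 := by nlinarith
      omega
    have h4 : (⟨q - 1, hlast⟩ : Fin q) = i := by
      ext
      rw [h3] at heq
      simp only
      omega
    rw [h4, hk, h3, mul_zero, WithZero.exp_zero]
  -- Euler's formula: the coefficient of degree q - 1 is ∑ P(wπ) / D w, which is z times the trace
  -- of x.
  have hsum := Lagrange.coeff_eq_sum hinj hPdeg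
  rw [Finset.card_univ, ← Nat.card_eq_fintype_card, ← hq, hcoeff] at hsum
  have hterm : ∀ w : W, P.eval (w.1 π) / D w = w.1 x * z := by
    intro w
    have hzw : w.1 z = z := (IntermediateField.mem_fixedField_iff W _).1 hz w.1 w.2
    rw [hPeval, map_mul, map_mul, ← hD, hzw]
    have := hD0 w
    field_simp
  rw [Finset.sum_congr rfl fun w _ => hterm w, ← Finset.sum_mul] at hsum
  have h := congrArg (Valued.v : Valuation L ℤᵐ⁰) hsum
  rw [hvlast, map_mul, hvz] at h
  rw [WithZero.exp_neg]
  exact eq_inv_of_mul_eq_one_left h.symm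

end IsTotallyRamified
end WildTrace

/-! ### The estimate for the wild layer. -/

section WildGenerator

variable {M L : Type*} [Field M] [Field L] [Algebra M L] [Valued M ℤᵐ⁰] [Valued L ℤᵐ⁰]
  [IsCompleteLocalField M] [IsCompleteLocalField L] [FiniteDimensional M L] [IsGalois M L]

namespace IsTotallyRamified

theorem val_le_exp_of_mem_fixedField (htot : IsTotallyRamified M L) {H : Subgroup Gal(L/M)} {x : L}
    (hx : x ∈ IntermediateField.fixedField H) (h1 : (Valued.v x : ℤᵐ⁰) < 1) :
    (Valued.v x : ℤᵐ⁰) ≤ WithZero.exp (-(Nat.card H : ℤ)) := by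
  rcases eq_or_ne x 0 with rfl | h0
  · simp
  obtain ⟨k, hk⟩ := htot.exists_val_fixedField H hx h0
  have hpos : (0 : ℤ) < Nat.card H := by exact_mod_cast Nat.card_pos
  rw [hk, ← WithZero.exp_zero, WithZero.exp_lt_exp] at h1
  rw [hk, WithZero.exp_le_exp]
  have : k < 0 := by nlinarith
  nlinarith

/-- The case of coefficients in `𝒪[M]`, to which coefficients in the fixed field of `W` are reduced
below. -/
theorem val_lt_one_of_sum_le [Finite 𝓀[M]] (htot : IsTotallyRamified M L)
    (hweak : IsWeaklyRamified M L) {W : Subgroup Gal(L/M)} (hW : W = ramificationGroup M L 1)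
    [Fintype W] {m : ℤ} {x : L} (hx : (Valued.v x : ℤᵐ⁰) = WithZero.exp (-(1 + m * Nat.card W)))
    (r : W → 𝒪[M])
    (hr : (Valued.v (∑ w : W, algebraMap M L (r w) * w.1 x) : ℤᵐ⁰) ≤
      Valued.v x * WithZero.exp (-(Nat.card W : ℤ))) (w : W) :
    (Valued.v (r w : M) : ℤᵐ⁰) < 1 := by
  classical
  obtain ⟨p, hp, hchar, hpM⟩ := Valued.exists_prime_charP_residue (K := M)
  have := Fact.mk hp
  have hWp : IsPGroup p W := hW ▸ htot.isPGroup_ramificationGroup_one hweak hpM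
  let K₀ : AddSubgroup (W → 𝒪[M]) :=
    { carrier := {r | (Valued.v (∑ w : W, algebraMap M L (r w) * w.1 x) : ℤᵐ⁰) ≤
        Valued.v x * WithZero.exp (-(Nat.card W : ℤ))}
      zero_mem' := by simp
      add_mem' := fun {a b} ha hb => by
        have h : ∑ w : W, algebraMap M L ((a + b) w : 𝒪[M]) * w.1 x =
            ∑ w : W, algebraMap M L (a w) * w.1 x + ∑ w : W, algebraMap M L (b w) * w.1 x := by
          rw [← Finset.sum_add_distrib]
          refine Finset.sum_congr rfl fun w _ => ?_
          rw [Pi.add_apply, Subring.coe_add, map_add, add_mul]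
        rw [Set.mem_ofPred_eq, h]
        exact (Valuation.map_add _ _ _).trans (max_le ha hb)
      neg_mem' := fun {a} ha => by
        have h : ∑ w : W, algebraMap M L ((-a) w : 𝒪[M]) * w.1 x =
            -∑ w : W, algebraMap M L (a w) * w.1 x := by
          rw [← Finset.sum_neg_distrib]
          refine Finset.sum_congr rfl fun w _ => ?_
          rw [Pi.neg_apply, NegMemClass.coe_neg, map_neg, neg_mul]
        rw [Set.mem_ofPred_eq, h, Valuation.map_neg]
        exact ha }
  let res : (W → 𝒪[M]) →+ (W → 𝓀[M]) :=
    (IsLocalRing.residue 𝒪[M]).toAddMonoidHom.compLeft W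
  have hres : ∀ s w, res s w = IsLocalRing.residue 𝒪[M] (s w) := fun s w => rfl
  have htrans : ∀ (g : W) (s : W → 𝒪[M]), s ∈ K₀ → (fun a => s (g⁻¹ * a)) ∈ K₀ := by
    intro g s hs
    have h : ∑ w : W, algebraMap M L (s (g⁻¹ * w)) * w.1 x =
        g.1 (∑ w : W, algebraMap M L (s w) * w.1 x) := by
      rw [map_sum]
      refine Fintype.sum_equiv (Equiv.mulLeft g⁻¹) _ _ fun w => ?_
      rw [map_mul, AlgEquiv.commutes, ← AlgEquiv.mul_apply, ← Subgroup.coe_mul]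
      simp
    change (Valued.v (∑ w : W, algebraMap M L (s (g⁻¹ * w)) * w.1 x) : ℤᵐ⁰) ≤ _
    rw [h, htot.val_apply]
    exact hs
  -- The residue vectors of all relations: a finite group killed by p and stable under translation
  -- by `W`. If nonzero, its number of fixed vectors is divisible by p, so some fixed vector is
  -- nonzero; fixed vectors are constant.
  let K := K₀.map res
  let act : MulAction W K :=
    { smul := fun g f => ⟨fun a => f.1 (g⁻¹ * a), by
        obtain ⟨s, hs, hsf⟩ := f.2
        exact ⟨_, htrans g s hs, by ext a; rw [← hsf]; rfl⟩⟩
      one_smul := fun f => Subtype.ext (funext fun a => by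
        change f.1 (1⁻¹ * a) = f.1 a
        rw [inv_one, one_mul])
      mul_smul := fun g h f => Subtype.ext (funext fun a => by
        change f.1 ((g * h)⁻¹ * a) = f.1 (h⁻¹ * (g⁻¹ * a))
        rw [mul_inv_rev, mul_assoc]) }
  rw [← Valued.residue_eq_zero_iff_val_lt_one]
  by_contra hne
  let f₀ : K := ⟨res r, r, hr, rfl⟩
  have hf₀ : f₀ ≠ 0 := fun h => hne (congrFun (congrArg Subtype.val h) w)
  have hpK : p ∣ Nat.card K := by
    have h : addOrderOf f₀ = p := addOrderOf_eq_prime (Subtype.ext (funext fun a => by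
      change p • (f₀.1 a) = 0
      rw [nsmul_eq_mul, CharP.cast_eq_zero, zero_mul])) hf₀
    exact h ▸ addOrderOf_dvd_natCard f₀
  have hzero : (0 : K) ∈ MulAction.fixedPoints W K := fun g => Subtype.ext rfl
  obtain ⟨f, hf, hf0⟩ := hWp.exists_fixed_point_of_prime_dvd_card_of_fixed_point K hpK hzero
  have hconst : ∀ a, f.1 a = f.1 1 := by
    intro a
    have h := congrFun (congrArg Subtype.val (hf a)) a
    change f.1 (a⁻¹ * a) = f.1 a at h
    rw [← h, inv_mul_cancel]
  obtain ⟨s, hs, hsf⟩ := f.2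
  have hs1 : (Valued.v (s 1 : M) : ℤᵐ⁰) = 1 := by
    refine le_antisymm (s 1).2 (not_lt.1 fun hlt => hf0 (Subtype.ext (funext fun a => ?_)))
    rw [hconst, ← hsf, hres, (Valued.residue_eq_zero_iff_val_lt_one _).2 hlt]
    rfl
  have hdiff : ∀ a, (Valued.v (algebraMap M L (s a - s 1 : 𝒪[M])) : ℤᵐ⁰) ≤
      WithZero.exp (-(Nat.card W : ℤ)) := by
    intro a
    refine htot.val_le_exp_of_mem_fixedField
      ((IntermediateField.fixedField W).algebraMap_mem _) ?_
    rw [htot]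
    refine pow_lt_one₀ zero_le ?_ Module.finrank_pos.ne'
    rw [← Valued.residue_eq_zero_iff_val_lt_one, map_sub, ← hres, ← hres, hsf, hconst, sub_self]
  have hsum : algebraMap M L (s 1) * ∑ a : W, a.1 x =
      ∑ a : W, algebraMap M L (s a) * a.1 x -
        ∑ a : W, algebraMap M L (s a - s 1 : 𝒪[M]) * a.1 x := by
    rw [← Finset.sum_sub_distrib, Finset.mul_sum]
    refine Finset.sum_congr rfl fun a _ => ?_
    rw [AddSubgroupClass.coe_sub, map_sub]
    ring
  have hle : (Valued.v (algebraMap M L (s 1) * ∑ a : W, a.1 x) : ℤᵐ⁰) ≤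
      Valued.v x * WithZero.exp (-(Nat.card W : ℤ)) := by
    rw [hsum]
    refine (Valuation.map_sub _ _ _).trans (max_le hs (Valuation.map_sum_le _ fun a _ => ?_))
    rw [map_mul, htot.val_apply, mul_comm]
    exact mul_le_mul' le_rfl (hdiff a)
  -- The trace has additive valuation (m + 1)q, while the relation would force at least 1 + (m +
  -- 1)q.
  rw [map_mul, htot, hs1, one_pow, one_mul, htot.val_sum_ramificationGroup_one hweak hW hx, hx,
    WithZero.exp_mul_exp, WithZero.exp_le_exp] at hle
  linarith

/-- In a weakly ramified extension, an element whose valuation is `1` modulo the order of the wild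
inertia group `W` generates a fractional ideal over the group ring of `W` over the valuation ring of
the fixed field of `W`. -/
theorem val_mul_lt_val_sum_ramificationGroup_one [Finite 𝓀[M]] (htot : IsTotallyRamified M L)
    (hweak : IsWeaklyRamified M L) {W : Subgroup Gal(L/M)} (hW : W = ramificationGroup M L 1)
    [Fintype W] {m : ℤ} {x : L} (hx : (Valued.v x : ℤᵐ⁰) = WithZero.exp (-(1 + m * Nat.card W)))
    (e : W → L) (he : ∀ w, e w ∈ IntermediateField.fixedField W) {w₀ : W} (hw₀ : e w₀ ≠ 0) :
    (Valued.v (e w₀) * Valued.v x * WithZero.exp (-(Nat.card W : ℤ)) : ℤᵐ⁰) <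
      Valued.v (∑ w : W, e w * w.1 x) := by
  by_contra! hle
  -- Dividing by the largest coefficient makes all of them integral and one equal to 1.
  obtain ⟨w₁, -, hmax⟩ := Finset.univ.exists_max_image
    (fun w : W => (Valued.v (e w) : ℤᵐ⁰)) ⟨w₀, Finset.mem_univ _⟩
  have h0 : (Valued.v (e w₁) : ℤᵐ⁰) ≠ 0 := fun h => by
    have := hmax w₀ (Finset.mem_univ _)
    rw [h, le_zero_iff, map_eq_zero] at this
    exact hw₀ this
  have h1 : e w₁ ≠ 0 := fun h => h0 (by rw [h, map_zero])
  have hint : ∀ w, (Valued.v (e w / e w₁) : ℤᵐ⁰) ≤ 1 := by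
    intro w
    rw [map_div₀]
    exact div_le_one_of_le₀ (hmax w (Finset.mem_univ _)) zero_le
  -- Replacing coefficients by residue representatives in `M` changes them by elements of the fixed
  -- field of positive valuation, hence at least q, which the bound tolerates.
  choose r hr hrv using fun w => htot.exists_residue_eq (hint w)
  have hrq : ∀ w, (Valued.v (e w / e w₁ - algebraMap M L (r w)) : ℤᵐ⁰) ≤
      WithZero.exp (-(Nat.card W : ℤ)) := fun w =>
    htot.val_le_exp_of_mem_fixedField (sub_mem (div_mem (he w) (he w₁))
      ((IntermediateField.fixedField W).algebraMap_mem _)) (hrv w)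
  have hsum : ∑ w : W, algebraMap M L (r w) * w.1 x =
      (∑ w : W, e w * w.1 x) / e w₁ -
        ∑ w : W, (e w / e w₁ - algebraMap M L (r w)) * w.1 x := by
    rw [Finset.sum_div, ← Finset.sum_sub_distrib]
    refine Finset.sum_congr rfl fun w _ => ?_
    ring
  have hlt := htot.val_lt_one_of_sum_le hweak hW hx (fun w => ⟨r w, hr w⟩) (by
    change (Valued.v (∑ w : W, algebraMap M L (r w) * w.1 x) : ℤᵐ⁰) ≤ _
    rw [hsum]
    refine (Valuation.map_sub _ _ _).trans (max_le ?_ (Valuation.map_sum_le _ fun w _ => ?_))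
    · rw [map_div₀]
      refine div_le_of_le_mul₀ zero_le zero_le (hle.trans ?_)
      rw [mul_assoc, mul_comm]
      exact mul_le_mul' le_rfl (hmax w₀ (Finset.mem_univ _))
    · rw [map_mul, htot.val_apply, mul_comm]
      exact mul_le_mul' le_rfl (hrq w)) w₁
  have h2 := hrv w₁
  rw [div_self h1] at h2
  have h3 : (Valued.v (algebraMap M L (r w₁)) : ℤᵐ⁰) < 1 := by
    rw [htot]
    exact pow_lt_one₀ zero_le hlt Module.finrank_pos.ne'
  have h4 := Valuation.map_add_lt _ h2 h3
  rw [sub_add_cancel, map_one] at h4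
  exact lt_irrefl _ h4

end IsTotallyRamified
end WildGenerator

/-! ### Roots of unity and orthogonality. -/

section RootsOfUnity

theorem Valuation.map_pow_sub_one_lt_one {K Γ : Type*} [Field K]
    [LinearOrderedCommGroupWithZero Γ] (v : Valuation K Γ) {η : K} (h : v (η - 1) < 1) (n : ℕ) :
    v (η ^ n - 1) < 1 := by
  have h1 : v η ≤ 1 := by
    have := v.map_add (η - 1) 1
    rw [sub_add_cancel, map_one] at this
    exact this.trans (max_le h.le le_rfl)
  rw [← mul_geom_sum, map_mul]
  refine mul_lt_one_of_lt_of_le h (v.map_sum_le fun i _ => ?_)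
  rw [map_pow]
  exact pow_le_one₀ zero_le h1

/-- A principal unit that is a root of unity of order prime to the residue characteristic is `1`. -/
theorem Valuation.eq_one_of_pow_eq_one {K Γ : Type*} [Field K]
    [LinearOrderedCommGroupWithZero Γ] (v : Valuation K Γ) {η : K} {n : ℕ} (hη : η ^ n = 1)
    (hn : v (n : K) = 1) (h : v (η - 1) < 1) : η = 1 := by
  by_contra hne
  have hgeom : ∑ i ∈ Finset.range n, η ^ i = 0 := by
    have := mul_geom_sum η n
    rw [hη, sub_self] at this
    exact (mul_eq_zero.1 this).resolve_left (sub_ne_zero.2 hne)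
  -- If η ≠ 1, its powers sum to zero, which exhibits n as a sum of non-units.
  have hsum : (n : K) = -∑ i ∈ Finset.range n, (η ^ i - 1) := by
    rw [Finset.sum_sub_distrib, hgeom]
    simp
  have hlt : v (n : K) < 1 := by
    rw [hsum, v.map_neg]
    exact v.map_sum_lt one_ne_zero fun i _ => v.map_pow_sub_one_lt_one h i
  exact hlt.ne hn

theorem Fin.sum_div_pow_eq_ite {K : Type*} [Field K] {n : ℕ} {x y : K} (hx : x ^ n = 1)
    (hy : y ^ n = 1) [Decidable (x = y)] (hy0 : y ≠ 0) :
    ∑ i : Fin n, (x / y) ^ (i : ℕ) = if x = y then (n : K) else 0 := by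
  rw [Fin.sum_univ_eq_sum_range fun i => (x / y) ^ i]
  split_ifs with h
  · simp [h, div_self hy0]
  · have h1 := mul_geom_sum (x / y) n
    rw [div_pow, hx, hy, div_one, sub_self] at h1
    refine (mul_eq_zero.1 h1).resolve_left fun e => h ?_
    exact (div_eq_one_iff_eq hy0).1 (sub_eq_zero.1 e)

end RootsOfUnity

/-! ### The estimate for the tame layer. -/

section TameGenerator

variable {M L : Type*} [Field M] [Field L] [Algebra M L] [Valued M ℤᵐ⁰] [Valued L ℤᵐ⁰]
  [IsCompleteLocalField M] [IsCompleteLocalField L] [FiniteDimensional M L] [IsGalois M L]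

namespace IsTotallyRamified

/-- A tame complement acts on a radical uniformizer of the tame subextension through a faithful
character with values in the base field. -/
theorem exists_tame_character [Finite 𝓀[M]] (htot : IsTotallyRamified M L)
    {W C : Subgroup Gal(L/M)} (hW : W = ramificationGroup M L 1) (hWC : Disjoint W C) {ϖ : L}
    (hϖ : ϖ ∈ IntermediateField.fixedField W)
    (hvϖ : (Valued.v ϖ : ℤᵐ⁰) = WithZero.exp (-(Nat.card W : ℤ))) {πM : M}
    (hpow : ϖ ^ Nat.card C = algebraMap M L πM) :
    (Valued.v (Nat.card C : L) : ℤᵐ⁰) = 1 ∧ ∃ χ : C → M, Function.Injective χ ∧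
      ∀ g : C, χ g ^ Nat.card C = 1 ∧ g.1 ϖ = algebraMap M L (χ g) * ϖ := by
  obtain ⟨p, hp, -, hpM⟩ := Valued.exists_prime_charP_residue (K := M)
  have hc : (Valued.v (Nat.card C : L) : ℤᵐ⁰) = 1 :=
    htot.val_natCast_eq_one hp hpM (htot.not_dvd_card_of_disjoint hp hpM (hW ▸ hWC))
  have hϖ0 : ϖ ≠ 0 := by rintro rfl; exact WithZero.exp_ne_zero (hvϖ.symm.trans (map_zero _))
  have hcpos : Nat.card C ≠ 0 := Nat.card_pos.ne'
  have hroot : ∀ g : C, (g.1 ϖ / ϖ) ^ Nat.card C = 1 := by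
    intro g
    rw [div_pow, ← map_pow, hpow, AlgEquiv.commutes, div_self]
    rw [← hpow]
    exact pow_ne_zero _ hϖ0
  have hval : ∀ g : C, (Valued.v (g.1 ϖ / ϖ) : ℤᵐ⁰) = 1 := by
    intro g
    rw [map_div₀, htot.val_apply, div_self ((Valuation.ne_zero_iff _).2 hϖ0)]
  have hmem : ∀ g : C, ∃ a : M, algebraMap M L a = g.1 ϖ / ϖ := by
    intro g
    have hg0 : g.1 ϖ / ϖ ≠ 0 := (Valuation.ne_zero_iff Valued.v).1 (by rw [hval]; exact one_ne_zero)
    -- For η = g(ϖ)/ϖ, the quotient τ(η)/η is both a c-th root of unity and a principal unit, hence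
    -- 1; so η lies in `M`.
    refine (IsGalois.mem_range_algebraMap_iff_fixed _).2 fun τ => ?_
    refine (div_eq_one_iff_eq hg0).1
      (Valuation.eq_one_of_pow_eq_one Valued.v (n := Nat.card C) ?_ hc ?_)
    · rw [div_pow, ← map_pow, hroot, map_one, div_one]
    · rw [div_sub_one hg0, map_div₀, hval, div_one]
      exact htot.val_apply_sub_lt_one τ (hval g).le
  choose χ hχ using hmem
  have hact : ∀ g : C, g.1 ϖ = algebraMap M L (χ g) * ϖ := fun g => by
    rw [hχ, div_mul_cancel₀ _ hϖ0]
  refine ⟨hc, χ, ?_, fun g => ⟨?_, hact g⟩⟩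
  · intro g h hgh
    have hfix : (h⁻¹ * g).1 ϖ = ϖ := by
      rw [Subgroup.coe_mul, AlgEquiv.mul_apply, hact g, hgh, ← hact h, ← AlgEquiv.mul_apply,
        ← Subgroup.coe_mul, inv_mul_cancel, Subgroup.coe_one, AlgEquiv.one_apply]
    -- Equal characters make `H` fix ϖ, whose valuation is |W|. Valuations on the fixed field of `H`
    -- are multiples of |H|, so H = W.
    let H : Subgroup Gal(L/M) := W ⊔ Subgroup.zpowers (h⁻¹ * g).1
    have hH : ϖ ∈ IntermediateField.fixedField H := by
      rw [IntermediateField.mem_fixedField_iff]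
      have hle : H ≤ MulAction.stabilizer Gal(L/M) ϖ := by
        refine sup_le (fun w hw => ?_) ?_
        · exact (IntermediateField.mem_fixedField_iff W _).1 hϖ w hw
        · rw [Subgroup.zpowers_le]
          exact hfix
      exact fun f hf => hle hf
    obtain ⟨k, hk⟩ := htot.exists_val_fixedField H hH hϖ0
    rw [hvϖ, WithZero.exp_inj] at hk
    have hdvd : Nat.card H ∣ Nat.card W := by
      rw [← Int.natCast_dvd_natCast]
      exact ⟨-k, by linarith⟩
    have hWH : W = H := Subgroup.eq_of_le_of_card_ge le_sup_left (Nat.le_of_dvd Nat.card_pos hdvd)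
    have hmemW : (h⁻¹ * g).1 ∈ W := by
      rw [hWH]
      exact le_sup_right (a := W) (Subgroup.mem_zpowers _)
    have h1 := Subgroup.disjoint_def.1 hWC hmemW (h⁻¹ * g).2
    exact (inv_mul_eq_one.1 (Subtype.ext h1)).symm
  · apply (algebraMap M L).injective
    rw [map_pow, hχ, hroot, map_one]

/-- A sum of unit multiples of the powers of a radical uniformizer of the tame subextension,
multiplied by a power of that uniformizer, generates a fractional ideal over the group ring of a
tame complement. -/
theorem val_mul_lt_val_sum_tame [Finite 𝓀[M]] (htot : IsTotallyRamified M L)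
    {W C : Subgroup Gal(L/M)} (hW : W = ramificationGroup M L 1) (hWC : W.IsComplement' C)
    [Fintype C] {ϖ : L} (hϖ : ϖ ∈ IntermediateField.fixedField W)
    (hvϖ : (Valued.v ϖ : ℤᵐ⁰) = WithZero.exp (-(Nat.card W : ℤ))) {πM : M}
    (hpow : ϖ ^ Nat.card C = algebraMap M L πM) (u : Fin (Nat.card C) → M)
    (hu : ∀ i, (Valued.v (u i) : ℤᵐ⁰) = 1) (t : ℤ) (r : C → M) {g₀ : C} (hr : r g₀ ≠ 0) :
    (Valued.v (algebraMap M L (r g₀)) * Valued.v (ϖ ^ t) *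
        WithZero.exp (-(Module.finrank M L : ℤ)) : ℤᵐ⁰) <
      Valued.v (∑ g : C, algebraMap M L (r g) *
        g.1 (ϖ ^ t * ∑ i, algebraMap M L (u i) * ϖ ^ (i : ℕ))) := by
  classical
  obtain ⟨hc, χ, hinj, hχ⟩ := htot.exists_tame_character hW hWC.disjoint hϖ hvϖ hpow
  have hϖ0 : ϖ ≠ 0 := by rintro rfl; exact WithZero.exp_ne_zero (hvϖ.symm.trans (map_zero _))
  have hN : Module.finrank M L = Nat.card W * Nat.card C := by
    rw [hWC.card_mul_card, IsGalois.card_aut_eq_finrank]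
  have hqpos : (0 : ℤ) < Nat.card W := by exact_mod_cast Nat.card_pos
  have hχ0 : ∀ g, χ g ≠ 0 := fun g h => by
    have := (hχ g).1
    rw [h, zero_pow Nat.card_pos.ne'] at this
    exact zero_ne_one this
  have hvχ : ∀ g, (Valued.v (algebraMap M L (χ g)) : ℤᵐ⁰) = 1 := fun g => by
    rw [← pow_eq_one_iff_of_nonneg zero_le (Nat.card_pos (α := C)).ne', ← map_pow, ← map_pow,
      (hχ g).1, map_one, map_one]
  -- The Fourier transform of `r` on `C`, twisted by `t`.
  let s : Fin (Nat.card C) → M := fun i => ∑ g : C, r g * (χ g ^ t * χ g ^ (i : ℕ))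
  have hsum : ∑ g : C, algebraMap M L (r g) *
        g.1 (ϖ ^ t * ∑ i, algebraMap M L (u i) * ϖ ^ (i : ℕ)) =
      ∑ i, algebraMap M L (u i * s i) * (ϖ ^ t * ϖ ^ (i : ℕ)) := by
    simp only [s, map_mul, map_sum, map_zpow₀, map_pow, AlgEquiv.commutes, (hχ _).2,
      Finset.mul_sum, Finset.sum_mul, mul_zpow, mul_pow]
    rw [Finset.sum_comm]
    refine Finset.sum_congr rfl fun i _ => Finset.sum_congr rfl fun g _ => ?_
    ring
  have hterm : ∀ i, (Valued.v (algebraMap M L (s i)) * (Valued.v (ϖ ^ t) * Valued.v ϖ ^ (i : ℕ)) :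
      ℤᵐ⁰) ≤ Valued.v (∑ i, algebraMap M L (u i * s i) * (ϖ ^ t * ϖ ^ (i : ℕ))) := by
    intro i
    have hv : ∀ i : Fin (Nat.card C),
        (Valued.v (algebraMap M L (u i * s i) * (ϖ ^ t * ϖ ^ (i : ℕ))) : ℤᵐ⁰) =
        Valued.v (algebraMap M L (s i)) * (Valued.v (ϖ ^ t) * Valued.v ϖ ^ (i : ℕ)) := by
      intro i
      rw [map_mul, map_mul, map_mul, htot (u i), hu, one_pow, one_mul, map_mul, map_pow]
    rw [← hv]
    refine Valuation.le_map_sum_of_injOn _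
      (f := fun i : Fin (Nat.card C) => algebraMap M L (u i * s i) * (ϖ ^ t * ϖ ^ (i : ℕ)))
      ?_ (Finset.mem_univ i)
    intro i _ j _ hi hij
    have hj := hi
    rw [hij] at hj
    simp only [hv] at hi hj hij
    have hsi : s i ≠ 0 := fun h => hi (by rw [h, map_zero, map_zero, zero_mul])
    have hsj : s j ≠ 0 := fun h => hj (by rw [h, map_zero, map_zero, zero_mul])
    obtain ⟨k, hk⟩ := htot.exists_val_algebraMap _ hsi
    obtain ⟨l, hl⟩ := htot.exists_val_algebraMap _ hsj
    rw [hk, hl, map_zpow₀, hvϖ, WithZero.exp_zpow_eq, WithZero.exp_pow_eq, WithZero.exp_pow_eq,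
      WithZero.exp_mul_exp, WithZero.exp_mul_exp, WithZero.exp_mul_exp, WithZero.exp_mul_exp,
      WithZero.exp_inj, hN] at hij
    push_cast at hij
    refine Fin.eq_of_mul_sub_eq (k := k) (l := l) (mul_left_cancel₀ hqpos.ne' ?_)
    linarith
  have hinv : (Nat.card C : M) * r g₀ = ∑ i, s i * ((χ g₀ ^ t)⁻¹ * (χ g₀ ^ (i : ℕ))⁻¹) := by
    simp only [s, Finset.sum_mul]
    rw [Finset.sum_comm]
    have h : ∀ g : C, ∑ i : Fin (Nat.card C),
        r g * (χ g ^ t * χ g ^ (i : ℕ)) * ((χ g₀ ^ t)⁻¹ * (χ g₀ ^ (i : ℕ))⁻¹) =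
        r g * (χ g / χ g₀) ^ t * if g = g₀ then (Nat.card C : M) else 0 := by
      intro g
      have h1 := Fin.sum_div_pow_eq_ite (hχ g).1 (hχ g₀).1 (hχ0 g₀)
      simp only [hinj.eq_iff] at h1
      rw [← h1, Finset.mul_sum]
      refine Finset.sum_congr rfl fun i _ => ?_
      rw [div_zpow, div_pow]
      ring
    rw [Finset.sum_congr rfl fun g _ => h g, Finset.sum_eq_single g₀]
    · rw [if_pos rfl, div_self (hχ0 g₀), one_zpow]
      ring
    · intro g _ hg
      rw [if_neg hg, mul_zero]
    · simp
  have hr0 : (Valued.v (algebraMap M L (r g₀)) : ℤᵐ⁰) ≠ 0 := by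
    rw [Valuation.ne_zero_iff, Ne, map_eq_zero]
    exact hr
  -- In the inversion formula both c and the character values are units, so some `s i` is at least
  -- as large as `r g₀`.
  obtain ⟨i, hi⟩ : ∃ i, (Valued.v (algebraMap M L (r g₀)) : ℤᵐ⁰) ≤
      Valued.v (algebraMap M L (s i)) := by
    by_contra! hlt
    have h1 := congrArg (fun x => (Valued.v (algebraMap M L x) : ℤᵐ⁰)) hinv
    simp only [map_mul, map_natCast, hc, one_mul, map_sum] at h1
    refine lt_irrefl _ (h1.trans_lt (Valuation.map_sum_lt _ hr0 fun i _ => ?_))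
    rw [map_mul, map_mul, map_inv₀, map_inv₀, map_inv₀, map_inv₀, map_zpow₀, map_zpow₀, map_pow,
      map_pow, hvχ]
    simpa using hlt i
  rw [hsum]
  refine lt_of_lt_of_le ?_ (hterm i)
  rw [mul_assoc]
  have hϖt : (Valued.v (ϖ ^ t) : ℤᵐ⁰) ≠ 0 := (Valuation.ne_zero_iff _).2 (zpow_ne_zero _ hϖ0)
  refine mul_lt_mul_of_le_of_lt_of_pos_of_nonneg hi ?_ (zero_lt_iff.2 hr0) zero_le
  refine (mul_lt_mul_iff_right₀ (zero_lt_iff.2 hϖt)).2 ?_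
  -- The factor ϖ^i costs only qi < qc = N.
  rw [hvϖ, WithZero.exp_pow_eq, WithZero.exp_lt_exp, hN]
  have := i.2
  push_cast
  nlinarith

end IsTotallyRamified
end TameGenerator

/-! ### From the valuation estimate to free generation. -/

section FreeGenerator

variable {M L : Type*} [Field M] [Field L] [Algebra M L] [Valued M ℤᵐ⁰] [Valued L ℤᵐ⁰]
  [IsCompleteLocalField M] [IsCompleteLocalField L] [FiniteDimensional M L] [IsGalois M L]

namespace IsTotallyRamified

/-- A valuative criterion for an element of valuation `n` to generate `𝔓 ^ n` freely over the
group ring of the Galois group. -/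
theorem isFreeGenerator_of_val_mul_lt (htot : IsTotallyRamified M L) {n : ℤ} {δ : L}
    (hδ : (Valued.v δ : ℤᵐ⁰) = WithZero.exp (-n))
    (h : ∀ (r : Gal(L/M) → M) (σ₀ : Gal(L/M)), r σ₀ ≠ 0 →
      (Valued.v (algebraMap M L (r σ₀)) * WithZero.exp (-n) *
        WithZero.exp (-(Module.finrank M L : ℤ)) : ℤᵐ⁰) <
      Valued.v (∑ σ, algebraMap M L (r σ) * σ δ)) :
    IsFreeGenerator M (idealPow L n : Set L) δ := by
  have hact : ∀ x : MonoidAlgebra 𝒪[M] Gal(L/M),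
      groupRingAction M L x δ = ∑ σ, algebraMap M L (x.coeff σ) * σ δ := by
    intro x
    rw [groupRingAction_apply, Finsupp.sum_fintype]
    intro σ
    simp
  refine ⟨fun x _ => ?_, fun x _ y _ hxy => ?_, fun y hy => ?_⟩
  · rw [SetLike.mem_coe, mem_idealPow]
    change (Valued.v (groupRingAction M L x δ) : ℤᵐ⁰) ≤ _
    rw [hact]
    refine Valuation.map_sum_le _ fun σ _ => ?_
    rw [map_mul, htot.val_apply, hδ]
    exact mul_le_of_le_one_left' (htot.val_algebraMap_le_one.2 (x.coeff σ).2)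
  · have hsub : ∑ σ, algebraMap M L (x.coeff σ - y.coeff σ) * σ δ = 0 := by
      have h1 : groupRingAction M L x δ = groupRingAction M L y δ := hxy
      rw [hact, hact, ← sub_eq_zero, ← Finset.sum_sub_distrib] at h1
      rw [← h1]
      refine Finset.sum_congr rfl fun σ _ => ?_
      rw [map_sub, sub_mul]
    have hcoeff : x.coeff = y.coeff := by
      ext σ
      by_contra hne
      have h2 := h (fun σ => (x.coeff σ - y.coeff σ : M)) σ (sub_ne_zero.2 hne)
      rw [hsub, map_zero] at h2
      exact not_lt_zero h2
    exact MonoidAlgebra.coeff_injective hcoeff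
  · have hli : LinearIndependent M fun σ : Gal(L/M) => σ δ := by
      rw [Fintype.linearIndependent_iff]
      intro r hr σ
      by_contra hne
      have h2 := h r σ hne
      simp only [← Algebra.smul_def, hr, map_zero] at h2
      exact not_lt_zero h2
    have hspan := hli.span_eq_top_of_card_eq_finrank'
      (by rw [← Nat.card_eq_fintype_card, IsGalois.card_aut_eq_finrank])
    obtain ⟨r, hr⟩ := (Submodule.mem_span_range_iff_exists_fun M).1
      (hspan ▸ Submodule.mem_top : y ∈ _)
    have hint : ∀ σ, (Valued.v (r σ) : ℤᵐ⁰) ≤ 1 := by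
      intro σ
      rcases eq_or_ne (r σ) 0 with h0 | h0
      · simp [h0]
      have h2 := h r σ h0
      simp only [← Algebra.smul_def, hr] at h2
      obtain ⟨k, hk⟩ := WithZero.eq_exp_log ((Valuation.ne_zero_iff Valued.v).2 h0)
      have h3 := h2.trans_le (mem_idealPow.1 hy)
      rw [htot, hk, WithZero.exp_pow_eq, WithZero.exp_mul_exp, WithZero.exp_mul_exp,
        WithZero.exp_lt_exp] at h3
      rw [hk, ← WithZero.exp_zero, WithZero.exp_le_exp]
      have hN : (0 : ℤ) < Module.finrank M L := by exact_mod_cast Module.finrank_pos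
      -- The allowance N in the criterion is exactly one step in the value group of `M`, so the
      -- strict inequality yields integrality.
      have h4 : (Module.finrank M L : ℤ) * k < Module.finrank M L * 1 := by linarith
      have := lt_of_mul_lt_mul_left h4 hN.le
      omega
    refine ⟨MonoidAlgebra.ofCoeff (Finsupp.equivFunOnFinite.symm fun σ => ⟨r σ, hint σ⟩),
      Set.mem_univ _, ?_⟩
    change groupRingAction M L _ δ = y
    rw [hact, ← hr]
    refine Finset.sum_congr rfl fun σ _ => ?_
    rw [Algebra.smul_def]
    rfl

end IsTotallyRamified
end FreeGenerator

/-! ### Combining the tame and wild estimates. -/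

theorem proposition6p1 {M L : Type*} [Field M] [Field L] [Algebra M L]
    [Valued M ℤᵐ⁰] [Valued L ℤᵐ⁰] [IsCompleteLocalField M] [IsCompleteLocalField L]
    [Finite 𝓀[M]] [FiniteDimensional M L] [IsGalois M L]
    (htot : IsTotallyRamified M L) (hweak : IsWeaklyRamified M L)
    (W C : Subgroup Gal(L/M)) (hW : W = ramificationGroup M L 1) (hWC : W.IsComplement' C)
    (πM : M) (hπM : IsUniformizerFor Valued.v πM)
    (πE : IntermediateField.fixedField W)
    (hπE : IsUniformizerFor
      (Valued.v.comap (algebraMap (IntermediateField.fixedField W) L)) πE)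
    (hπEM : πE ^ Nat.card C = algebraMap M (IntermediateField.fixedField W) πM)
    (πF : IntermediateField.fixedField C)
    (hπF : IsUniformizerFor
      (Valued.v.comap (algebraMap (IntermediateField.fixedField C) L)) πF)
    (a b : ℤ) (hab : a * (Nat.card W : ℤ) + b * (Nat.card C : ℤ) = 1)
    (n : ℤ) (hn : n ≡ 1 [ZMOD (Nat.card W : ℤ)])
    (u : Fin (Nat.card C) → 𝒪[M]ˣ) (α : L)
    (hα : α = ∑ i, algebraMap M L ((u i : 𝒪[M]) : M) * (πE : L) ^ (i : ℕ)) :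
    IsFreeGenerator M (idealPow L n : Set L)
      ((πF : L) ^ (n * b) * (πE : L) ^ (n * a) * α) := by
  classical
  have := Fintype.ofFinite W
  have := Fintype.ofFinite C
  have hpow : (πE : L) ^ Nat.card C = algebraMap M L πM := congrArg Subtype.val hπEM
  have hvE := htot.val_uniformizer_fixedField W hπE
  have hvF := htot.val_uniformizer_fixedField C hπF
  have hqpos : (0 : ℤ) < Nat.card W := by exact_mod_cast Nat.card_pos
  have hN : Module.finrank M L = Nat.card W * Nat.card C := by
    rw [hWC.card_mul_card, IsGalois.card_aut_eq_finrank]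
  have hu : ∀ i, (Valued.v ((u i : 𝒪[M]) : M) : ℤᵐ⁰) = 1 := fun i =>
    (Valuation.Integers.isUnit_iff_valuation_eq_one (Valuation.integer.integers Valued.v)).1
      (u i).isUnit
  obtain ⟨-, χ, -, hχ⟩ := htot.exists_tame_character hW hWC.disjoint πE.2 hvE hpow
  have hvα : (Valued.v α : ℤᵐ⁰) = 1 := by
    have hterm : ∀ i : Fin (Nat.card C),
        (Valued.v (algebraMap M L ((u i : 𝒪[M]) : M) * (πE : L) ^ (i : ℕ)) : ℤᵐ⁰) =
          WithZero.exp ((i : ℕ) * -(Nat.card W : ℤ)) := by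
      intro i
      rw [map_mul, htot, hu, one_pow, one_mul, map_pow, hvE, WithZero.exp_pow_eq]
    rw [hα, Valuation.map_sum_eq_of_lt Valued.v (j := ⟨0, Nat.card_pos⟩) (Finset.mem_univ _),
      hterm]
    · simp
    · intro i hi
      rw [hterm, hterm, WithZero.exp_lt_exp]
      have hi0 : (i : ℕ) ≠ 0 := fun h => by
        rw [Finset.mem_sdiff, Finset.mem_singleton] at hi
        exact hi.2 (Fin.ext h)
      have : (0 : ℤ) < (i : ℕ) := by omega
      push_cast
      nlinarith
  have hvFn : (Valued.v ((πF : L) ^ (n * b)) : ℤᵐ⁰) =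
      WithZero.exp (-(n - n * a * Nat.card W)) := by
    rw [map_zpow₀, hvF, WithZero.exp_zpow_eq]
    congr 1
    linear_combination (-n) * hab
  have hvEn : (Valued.v ((πE : L) ^ (n * a)) : ℤᵐ⁰) = WithZero.exp (-(n * a * Nat.card W)) := by
    rw [map_zpow₀, hvE, WithZero.exp_zpow_eq]
    congr 1
    ring
  obtain ⟨j, hj⟩ := hn.symm.dvd
  -- As n ≡ 1 mod q and n·a·q vanishes mod q, the power of `πF` meets the congruence needed in the
  -- wild layer.
  have hx : (Valued.v ((πF : L) ^ (n * b)) : ℤᵐ⁰) =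
      WithZero.exp (-(1 + (j - n * a) * Nat.card W)) := by
    rw [hvFn]
    congr 1
    linear_combination -hj
  refine htot.isFreeGenerator_of_val_mul_lt ?_ fun r σ₀ hr => ?_
  · rw [map_mul, map_mul, hvα, hvFn, hvEn, mul_one, WithZero.exp_mul_exp]
    congr 1
    ring
  let β : L := (πE : L) ^ (n * a) * ∑ i, algebraMap M L ((u i : 𝒪[M]) : M) * (πE : L) ^ (i : ℕ)
  have hβ : ∀ g : C, g.1 β ∈ IntermediateField.fixedField W := by
    intro g
    have hg : g.1 (πE : L) ∈ IntermediateField.fixedField W := by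
      rw [(hχ g).2]
      exact mul_mem ((IntermediateField.fixedField W).algebraMap_mem _) πE.2
    simp only [β, map_mul, map_zpow₀, map_sum, map_pow, AlgEquiv.commutes]
    exact mul_mem (zpow_mem hg _) (sum_mem fun i _ =>
      mul_mem ((IntermediateField.fixedField W).algebraMap_mem _) (pow_mem hg _))
  let e : W → L := fun w => ∑ g : C, algebraMap M L (r (w.1 * g.1)) * g.1 β
  have he : ∀ w, e w ∈ IntermediateField.fixedField W := fun w =>
    sum_mem fun g _ => mul_mem ((IntermediateField.fixedField W).algebraMap_mem _) (hβ g)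
  have hsum : ∑ σ, algebraMap M L (r σ) * σ ((πF : L) ^ (n * b) * (πE : L) ^ (n * a) * α) =
      ∑ w : W, e w * w.1 ((πF : L) ^ (n * b)) := by
    rw [← Fintype.sum_equiv (Equiv.ofBijective _ hWC) (fun y : W × C =>
      algebraMap M L (r (y.1.1 * y.2.1)) *
        (y.1.1 * y.2.1) ((πF : L) ^ (n * b) * (πE : L) ^ (n * a) * α)) _ fun y => rfl,
      Fintype.sum_prod_type]
    refine Finset.sum_congr rfl fun w _ => ?_
    rw [Finset.sum_mul]
    refine Finset.sum_congr rfl fun g _ => ?_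
    have h1 : g.1 ((πF : L) ^ (n * b)) = (πF : L) ^ (n * b) :=
      (IntermediateField.mem_fixedField_iff C _).1 (zpow_mem πF.2 _) g.1 g.2
    have h2 : w.1 (g.1 β) = g.1 β :=
      (IntermediateField.mem_fixedField_iff W _).1 (hβ g) w.1 w.2
    rw [hα, mul_assoc ((πF : L) ^ (n * b)), AlgEquiv.mul_apply, map_mul g.1, h1, map_mul w.1, h2]
    ring
  rw [hsum]
  obtain ⟨⟨w₀, g₀⟩, rfl⟩ := hWC.2 σ₀
  have htame := htot.val_mul_lt_val_sum_tame hW hWC πE.2 hvE hpow _ hu (n * a)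
    (fun g => r (w₀.1 * g.1)) (g₀ := g₀) hr
  have he0 : e w₀ ≠ 0 := (Valuation.ne_zero_iff Valued.v).1 (zero_le.trans_lt htame).ne'
  refine lt_of_le_of_lt ?_ (htot.val_mul_lt_val_sum_ramificationGroup_one hweak hW hx e he he0)
  obtain ⟨k, hk⟩ := htot.exists_val_fixedField W (he w₀) he0
  obtain ⟨l, hl⟩ := htot.exists_val_algebraMap _ hr
  change _ < (Valued.v (e w₀) : ℤᵐ⁰) at htame
  simp only at hl htame ⊢
  rw [hl, hk, hvEn, WithZero.exp_mul_exp, WithZero.exp_mul_exp, WithZero.exp_lt_exp, hN] at htame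
  rw [hl, hk, hvFn, WithZero.exp_mul_exp, WithZero.exp_mul_exp, WithZero.exp_mul_exp,
    WithZero.exp_mul_exp, WithZero.exp_le_exp, hN]
  push_cast at htame ⊢
  -- Both sides of the tame bound are multiples of q, so its strictness gains a full q, which
  -- offsets the q lost in the wild bound.
  have h1 : (Nat.card W : ℤ) * (Nat.card C * l - n * a - Nat.card C) < Nat.card W * k := by
    linarith
  have h2 := Int.add_one_le_iff.2 (lt_of_mul_lt_mul_left h1 hqpos.le)
  have h3 := mul_le_mul_of_nonneg_left h2 hqpos.le
  linarith
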